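/- Let $n\ge 1$ be an integer and let $a_k>0$, $d_k$, $\beta_k$ ($k=1,\dots,n$) be real numbers with $\sum_{k=1}^n a_k=1$ and $\sum_{k=1}^n a_k|d_k|^2<1$. Put $\alpha_0=0$, $\alpha_k=\alpha_{k-1}+a_k$. Let $P\in L_2[0,1]$ be the real self-similar function with these parameters, i.e. for every $k=1,\dots,n$ $$P(x)=d_k\,P\!\left(\frac{x-\alpha_{k-1}}{a_k}\right)+\beta_k\qquad\text{for almost every }x\in(\alpha_{k-1},\alpha_k).$$ Assume that $m\in\{1,\dots,n\}$ is such that $d_k=0$ for all $k\ne m$. For $k=1,\dots,n-1$ put $$\zeta_k=\begin{cases}\beta_m-\beta_{m-1}+d_m\beta_1,&k=m-1,\\ \beta_{m+1}-\beta_m-d_m\beta_n,&k=m,\\ \beta_{k+1}-\beta_k,&\text{otherwise,}\end{cases}\qquad Z_\pm=\#\{k\in\{1,\dots,n-1\}:\ \pm\zeta_k>0\}.$$ Consider the boundary value problem $-y''-\lambda\rho y=0$, $y(0)=y(1)=0$, with the weight $\rho=P'$ (generalized derivative). Let $\mathfrak H$ be the space of absolutely continuous $y:[0,1]\to\mathbb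 C$ with $y'\in L_2[0,1]$ and $y(0)=y(1)=0$. A real number $\lambda$ is an eigenvalue of the problem if there is a nonzero $y\in\mathfrak H$ such that $$\int_0^1\bigl(y'\,\overline{z'}+\lambda P\cdot(y\overline z)'\bigr)\,dx=0\qquad\text{for all }z\in\mathfrak H.$$ Suppose that $d_m>0$, $Z_->0$ and $Z_++Z_-=n-1$. Then the set of negative eigenvalues can be listed as an infinite strictly decreasing sequence $\lambda_{-1}>\lambda_{-2}>\cdots$, and there are real numbers $\mu_l>0$, $l=1,\dots,Z_-$, such that for every $l=1,\dots,Z_-$ $$\lambda_{-(l+kZ_-)}=-\mu_l\cdot(a_md_m)^{-k}\cdot(1+o(1))\qquad\text{as }k\to\infty .$$ -/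

import Mathlib

open MeasureTheory Filter Asymptotics
open scoped ComplexConjugate

namespace SelfSimilarSL

/-- The nodes `α_0 = 0`, `α_k = α_{k-1} + a_k`. -/
def node (a : ℕ → ℝ) : ℕ → ℝ
  | 0 => 0
  | k + 1 => node a k + a (k + 1)

/-- `P` is self-similar on `[0,1]` with parameters `n`, `a_k`, `d_k`, `β_k` (`k = 1, …, n`):
`P x = d_k P ((x - α_{k-1}) / a_k) + β_k` for almost every `x ∈ (α_{k-1}, α_k)`, that is,
`P` is a fixed point of the affine operator
`f ↦ ∑ k, (d_k f ((· - α_{k-1}) / a_k) + β_k) χ_{(α_{k-1}, α_k)}`. -/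
def IsSelfSimilar (n : ℕ) (a d β : ℕ → ℝ) (P : ℝ → ℝ) : Prop :=
  ∀ k ∈ Finset.Icc 1 n,
    ∀ᵐ x ∂(volume.restrict (Set.Ioo (node a (k - 1)) (node a k))),
      P x = d k * P ((x - node a (k - 1)) / a k) + β k

/-- The numbers `ζ_k`, `k = 1, …, n - 1` (the jump of `P` at `α_k`). -/
noncomputable def zeta (n m : ℕ) (d β : ℕ → ℝ) (k : ℕ) : ℝ :=
  if k + 1 = m then β m - β (m - 1) + d m * β 1
  else if k = m then β (m + 1) - β m - d m * β n
  else β (k + 1) - β k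

/-- `Z₊`, the number of `k ∈ [1, n - 1]` with `ζ_k > 0`. -/
noncomputable def zPos (n m : ℕ) (d β : ℕ → ℝ) : ℕ :=
  {k ∈ Finset.Icc 1 (n - 1) | 0 < zeta n m d β k}.card

/-- `Z₋`, the number of `k ∈ [1, n - 1]` with `-ζ_k > 0`. -/
noncomputable def zNeg (n m : ℕ) (d β : ℕ → ℝ) : ℕ :=
  {k ∈ Finset.Icc 1 (n - 1) | 0 < -zeta n m d β k}.card

/-- Membership in the Sobolev space of complex functions on `[0,1]` that are absolutely
continuous, have a square-integrable derivative and vanish at both end points. The values of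
`y` outside `[0,1]` play no role. -/
structure MemH (y : ℝ → ℂ) : Prop where
  absCont : AbsolutelyContinuousOnInterval y 0 1
  deriv_memLp : MemLp (deriv y) 2 (volume.restrict (Set.Icc 0 1))
  left : y 0 = 0
  right : y 1 = 0

/-- The sesquilinear form `∫₀¹ (y' z̄' + l P (y z̄)') dx` of the linear pencil `T_ρ(l)`, `ρ = P'`,
that is, the value of the functional `T_ρ(l) y` on the test function `z`. On the diagonal it is
`∫₀¹ (|y'|² + l P (|y|²)') dx`; and since `P (y z̄)'` integrates to `-⟨ρ y, z⟩`, it is the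
weak form of `-y'' - l ρ y`. -/
noncomputable def pencilForm (P : ℝ → ℝ) (l : ℝ) (y z : ℝ → ℂ) : ℂ :=
  ∫ x in (0 : ℝ)..1,
    (deriv y x * conj (deriv z x) + (l : ℂ) * (P x : ℂ) * deriv (fun t => y t * conj (z t)) x)

/-- The real number `l` is an eigenvalue of `-y'' - l ρ y = 0`, `y(0) = y(1) = 0`, where `ρ = P'`:
the pencil `T_ρ(l)` has a nonzero element in its kernel. -/
def IsEigenvalue (P : ℝ → ℝ) (l : ℝ) : Prop :=
  ∃ y : ℝ → ℂ, MemH y ∧ (∃ x ∈ Set.Icc (0 : ℝ) 1, y x ≠ 0) ∧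
    ∀ z : ℝ → ℂ, MemH z → pencilForm P l y z = 0

end SelfSimilarSL

/-!
A function `y` of the Sobolev space is recovered from its derivative, so the real Sobolev space is
the Hilbert space `EnergySpace` of square-integrable functions `f` with mean zero, with
`y = prim f`. The form `∫ P (y z)'` is bounded there and is represented by a symmetric operator
`weightOp P`; real and imaginary parts of an eigenfunction solve the same real equation, so `l < 0`
is an eigenvalue of the problem if and only if `-1 / l > 0` is one of `weightOp P`
(`isEigenvalue_iff`).

The self-similarity of `P` with a single nonzero `d m` is used in two ways. Near each inner node `P`
is constant on either side with jump `ζ_k`, so that a narrow tent at the node is tested by the form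
like a point mass; and on functions vanishing at all nodes the form is `d m` times the form of the
restriction to the `m`-th interval rescaled to the unit interval, since on the other intervals `P`
is constant. These facts are collected in `SelfSimilarOp`
(`weightForm_bump`, `weightForm_of_vanish`, `exists_selfSimilarOp`). They make the operator compact:
up to finite rank it is `d m` times its conjugate by a map of squared norm at most `a m`, and
`a m * d m < 1`.

Let `N s` be the largest dimension of a subspace on which the form exceeds `s ‖f‖²`. Transplanted
functions together with the tents at the `Z` nodes of negative jump give a lower bound for `N s`,
and correcting functions by tents at the nodes of positive jump gives an upper bound:
`N (s (1 + C s) / (a d)) + Z ≤ N s ≤ N (s (1 - C s) / (a d)) + Z` for small `s`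
(`SelfSimilarOp.exists_hasPosDim_bounds`). Here it is essential that every `ζ_k` is nonzero.

By the variational principle `N s` counts the eigenvalues above `s`, provided that they are simple
(`hasPosDim_iff_le_ncard`). Simplicity (`weightOp_simple`) comes from the integrated equation
`P y - ∫ P y' - t y' = C`, whose only solution with `C = 0` is zero by a Grönwall argument; so
eigenfunctions are determined by the constant `C`.

Finally, for the eigenvalues `ν 0 > ν 1 > ⋯` the bounds on `N` say that `a d ν i` and `ν (i + Z)`
agree up to a relative error of order `ν (i + Z)`. Along `i = j + k Z` these errors are summable, so
`ν (j + k Z) / (a d) ^ k` has a positive limit (`exists_tendsto_div_pow`).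
-/

namespace SelfSimilarSL

/-! ### Counting eigenvalues of a compact symmetric operator -/

section Counting

open Module End

variable {E : Type*} [NormedAddCommGroup E] [InnerProductSpace ℝ E]

/-- `A` has a `k`-dimensional subspace on which `⟪A u, u⟫ > s ‖u‖²` for `u ≠ 0`. The subspace is
given as the image of a linear map from `Fin k → ℝ`, which the inequality forces to be
injective. -/
def HasPosDim (A : E →L[ℝ] E) (s : ℝ) (k : ℕ) : Prop :=
  ∃ φ : (Fin k → ℝ) →ₗ[ℝ] E, ∀ x, x ≠ 0 → s * ‖φ x‖ ^ 2 < inner ℝ (A (φ x)) (φ x)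

theorem exists_injective_linearMap_of_le_finrank {X : Type*} [AddCommGroup X] [Module ℝ X]
    [FiniteDimensional ℝ X] {k : ℕ} (hk : k ≤ finrank ℝ X) :
    ∃ ι : (Fin k → ℝ) →ₗ[ℝ] X, Function.Injective ι := by
  refine ⟨Fintype.linearCombination ℝ (fun i : Fin k => finBasis ℝ X (Fin.castLE hk i)), ?_⟩
  rw [← linearIndependent_iff_injective_fintypeLinearCombination]
  exact (finBasis ℝ X).linearIndependent.comp _ (Fin.castLE_injective hk)

theorem HasPosDim.of_le_finrank {A : E →L[ℝ] E} {s : ℝ} {X : Type*} [AddCommGroup X] [Module ℝ X]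
    [FiniteDimensional ℝ X] {k : ℕ} (hk : k ≤ finrank ℝ X) (φ : X →ₗ[ℝ] E)
    (h : ∀ x, x ≠ 0 → s * ‖φ x‖ ^ 2 < inner ℝ (A (φ x)) (φ x)) : HasPosDim A s k := by
  obtain ⟨ι, hι⟩ := exists_injective_linearMap_of_le_finrank hk
  exact ⟨φ ∘ₗ ι, fun x hx => h _ (by rwa [Ne, map_eq_zero_iff ι hι])⟩

theorem HasPosDim.mono {A : E →L[ℝ] E} {s : ℝ} {j k : ℕ} (h : HasPosDim A s k) (hjk : j ≤ k) :
    HasPosDim A s j := by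
  obtain ⟨φ, hφ⟩ := h
  exact HasPosDim.of_le_finrank (by simpa using hjk) φ hφ

/-- A positive subspace of `A` of dimension `j + k` still has dimension `j` after imposing at most
`k` linear conditions, and `Q` maps what is left to a positive subspace of `B`. -/
theorem HasPosDim.of_conditions {A B : E →L[ℝ] E} {s s' : ℝ} {k j : ℕ} {ι : Type*} [Fintype ι]
    (h : HasPosDim A s (j + k)) (hk : Fintype.card ι ≤ k) (ev : ι → E →ₗ[ℝ] ℝ) (Q : E →ₗ[ℝ] E)
    (hQ : ∀ u, (∀ i, ev i u = 0) → s * ‖u‖ ^ 2 < inner ℝ (A u) u →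
      s' * ‖Q u‖ ^ 2 < inner ℝ (B (Q u)) (Q u)) :
    HasPosDim B s' j := by
  obtain ⟨φ, hφ⟩ := h
  set L : (Fin (j + k) → ℝ) →ₗ[ℝ] (ι → ℝ) := LinearMap.pi fun i => ev i ∘ₗ φ with hL
  have hfr := L.finrank_range_add_finrank_ker
  have hle : finrank ℝ (LinearMap.range L) ≤ Fintype.card ι := by
    simpa using (LinearMap.range L).finrank_le
  have hfin : finrank ℝ (Fin (j + k) → ℝ) = j + k := by simp
  refine HasPosDim.of_le_finrank (X := LinearMap.ker L) (by omega)
    (Q ∘ₗ φ ∘ₗ (LinearMap.ker L).subtype) ?_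
  rintro ⟨x, hx⟩ hx0
  refine hQ (φ x) (fun i => ?_) (hφ x (by simpa using hx0))
  exact congrFun (LinearMap.mem_ker.mp hx) i

/-- On sums of eigenvectors with eigenvalues at most `s`, the quadratic form is at most `s ‖x‖²`. -/
theorem inner_le_of_mem_iSup_eigenspace {A : E →L[ℝ] E} (hA : A.IsSymmetric) {s : ℝ} {x : E}
    (hx : x ∈ ⨆ μ : {μ : ℝ // μ ≤ s}, eigenspace (A : End ℝ E) μ.1) :
    inner ℝ (A x) x ≤ s * ‖x‖ ^ 2 := by
  classical
  rw [Submodule.mem_iSup_iff_exists_finsupp] at hx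
  obtain ⟨f, hf, rfl⟩ := hx
  have hAf : ∀ μ, A (f μ) = μ.1 • f μ := fun μ => mem_eigenspace_iff.mp (hf μ)
  have horth : ∀ μ ν, μ ≠ ν → inner ℝ (f μ) (f ν) = 0 := by
    intro μ ν hne
    exact (LinearMap.IsSymmetric.orthogonalFamily_eigenspaces hA)
      (fun h => hne (Subtype.ext h)) ⟨f μ, hf μ⟩ ⟨f ν, hf ν⟩
  have key : ∀ c : {μ : ℝ // μ ≤ s} → ℝ,
      inner ℝ (∑ μ ∈ f.support, c μ • f μ) (∑ μ ∈ f.support, f μ)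
        = ∑ μ ∈ f.support, c μ * ‖f μ‖ ^ 2 := by
    intro c
    rw [sum_inner]
    refine Finset.sum_congr rfl fun μ hμ => ?_
    rw [inner_sum, Finset.sum_eq_single μ]
    · rw [inner_smul_left, real_inner_self_eq_norm_sq]; rfl
    · intro ν _ hne
      rw [inner_smul_left, horth μ ν hne.symm, mul_zero]
    · exact fun h => absurd hμ h
  rw [Finsupp.sum, map_sum, ← real_inner_self_eq_norm_sq]
  have h1 := key (fun μ => μ.1)
  have h2 := key (fun _ => 1)
  simp only [one_smul, one_mul] at h2
  simp only [hAf]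
  rw [h1, h2, Finset.mul_sum]
  exact Finset.sum_le_sum fun μ _ => mul_le_mul_of_nonneg_right μ.2 (sq_nonneg _)

theorem HasPosDim.of_eigenvalues {A : E →L[ℝ] E} (hA : A.IsSymmetric) {s : ℝ} (T : Finset ℝ)
    (hT : ∀ t ∈ T, s < t ∧ HasEigenvalue (A : End ℝ E) t) : HasPosDim A s T.card := by
  classical
  choose! v hv using fun t (ht : t ∈ T) => (hT t ht).2.exists_hasEigenvector
  have hAv : ∀ t : T, A (v t) = t.1 • v t := fun t => mem_eigenspace_iff.mp (hv t t.2).1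
  have horth : ∀ t r : T, t ≠ r → inner ℝ (v t) (v r) = 0 := by
    intro t r hne
    exact (LinearMap.IsSymmetric.orthogonalFamily_eigenspaces hA)
      (fun h => hne (Subtype.ext h)) ⟨v t, (hv t t.2).1⟩ ⟨v r, (hv r r.2).1⟩
  refine HasPosDim.of_le_finrank (X := T → ℝ) (by simp)
    (Fintype.linearCombination ℝ (fun t : T => v t)) ?_
  intro x hx
  have key : ∀ c : T → ℝ,
      inner ℝ (∑ t : T, (c t * x t) • v t) (∑ t : T, x t • v t)
        = ∑ t : T, c t * (x t ^ 2 * ‖v t‖ ^ 2) := by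
    intro c
    rw [sum_inner]
    refine Finset.sum_congr rfl fun t _ => ?_
    rw [inner_sum, Finset.sum_eq_single t]
    · rw [inner_smul_left, inner_smul_right, real_inner_self_eq_norm_sq]
      simp only [conj_trivial]
      ring
    · intro r _ hne
      rw [inner_smul_left, inner_smul_right, horth t r hne.symm, mul_zero, mul_zero]
    · exact fun h => absurd (Finset.mem_univ t) h
  have h1 := key (fun t => t.1)
  have h2 := key (fun _ => 1)
  simp only [one_mul] at h2
  rw [Fintype.linearCombination_apply, map_sum, ← real_inner_self_eq_norm_sq]
  simp only [map_smul, hAv, smul_smul]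
  simp only [mul_comm (x _)]
  rw [h1, h2, Finset.mul_sum]
  obtain ⟨t, ht⟩ := Function.ne_iff.mp hx
  have hpos : ∀ r : T, 0 < ‖v r‖ ^ 2 := fun r => by
    have := (hv r r.2).2
    positivity
  refine Finset.sum_lt_sum (fun r _ => ?_) ⟨t, Finset.mem_univ t, ?_⟩
  · have := (hT r r.2).1
    have := hpos r
    gcongr
  · have := (hT t t.2).1
    have := hpos t
    have : 0 < x t ^ 2 := by
      have : x t ≠ 0 := ht
      positivity
    gcongr

theorem finite_eigenvalues_of_not_hasPosDim {A : E →L[ℝ] E} (hA : A.IsSymmetric) {s : ℝ} {N : ℕ}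
    (hN : ¬ HasPosDim A s N) : {t | s < t ∧ HasEigenvalue (A : End ℝ E) t}.Finite := by
  by_contra hinf
  obtain ⟨T, hT, hcard⟩ := Set.Infinite.exists_subset_card_eq hinf N
  exact hN (hcard ▸ HasPosDim.of_eigenvalues hA T fun t ht => hT ht)

/-- Variational principle: the largest dimension of a subspace on which `⟪A u, u⟫ > s ‖u‖²` is the
number of eigenvalues above `s`, when these are simple. -/
theorem hasPosDim_iff_le_ncard [CompleteSpace E] {A : E →L[ℝ] E} (hA : A.IsSymmetric)
    (hc : IsCompactOperator A) {s : ℝ}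
    (hsimple : ∀ t, s < t → ∀ x y, x ≠ 0 → A x = t • x → A y = t • y → ∃ c : ℝ, y = c • x)
    (hfin : {t | s < t ∧ HasEigenvalue (A : End ℝ E) t}.Finite) (k : ℕ) :
    HasPosDim A s k ↔ k ≤ {t | s < t ∧ HasEigenvalue (A : End ℝ E) t}.ncard := by
  classical
  set T := hfin.toFinset with hTdef
  have hT : ∀ t ∈ T, s < t ∧ HasEigenvalue (A : End ℝ E) t := fun t ht => by
    simpa [hTdef] using ht
  have hcard : {t | s < t ∧ HasEigenvalue (A : End ℝ E) t}.ncard = T.card :=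
    Set.ncard_eq_toFinset_card _ hfin
  rw [hcard]
  refine ⟨fun h => ?_, fun h => (HasPosDim.of_eigenvalues hA T hT).mono h⟩
  by_contra! hlt
  obtain ⟨φ, hφ⟩ := h
  choose! v hv using fun t (ht : t ∈ T) => (hT t ht).2.exists_hasEigenvector
  -- a subspace of larger dimension contains a vector orthogonal to all eigenvectors above `s`
  set L : (Fin k → ℝ) →ₗ[ℝ] (T → ℝ) :=
    LinearMap.pi fun t => ((innerSL ℝ (v t)) : E →ₗ[ℝ] ℝ) ∘ₗ φ with hL
  obtain ⟨x, hx, hx0⟩ := (LinearMap.ker L).ne_bot_iff.mp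
    (LinearMap.ker_ne_bot_of_finrank_lt (f := L) (by simpa using hlt))
  set u := φ x with hu
  have huv : ∀ t ∈ T, inner ℝ (v t) u = 0 := fun t ht =>
    congrFun (LinearMap.mem_ker.mp hx) ⟨t, ht⟩
  set G : Submodule ℝ E := ⨆ μ : {μ : ℝ // μ ≤ s}, eigenspace (A : End ℝ E) μ.1 with hG
  have hvG : ∀ t ∈ T, v t ∈ Gᗮ := by
    intro t ht
    rw [hG, ← Submodule.iInf_orthogonal, Submodule.mem_iInf]
    rintro ⟨μ, hμ⟩ y hy
    exact (LinearMap.IsSymmetric.orthogonalFamily_eigenspaces hA)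
      (ne_of_lt (lt_of_le_of_lt hμ (hT t ht).1)) ⟨y, hy⟩ ⟨v t, (hv t ht).1⟩
  have huG : u ∈ Gᗮᗮ := by
    -- the component of `u` orthogonal to `G` is orthogonal to all eigenvectors, hence zero
    obtain ⟨p, hp, r, hr, hpr⟩ := Submodule.exists_add_mem_mem_orthogonal (K := Gᗮ) u
    have hp0 : p ∈ (⨆ μ, eigenspace (A : End ℝ E) μ)ᗮ := by
      rw [← Submodule.iInf_orthogonal, Submodule.mem_iInf]
      intro μ y hy
      rcases le_or_gt μ s with hμ | hμ
      · exact hp y (Submodule.mem_iSup_of_mem (⟨μ, hμ⟩ : {μ : ℝ // μ ≤ s}) hy)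
      · by_cases hy0 : y = 0
        · simp [hy0]
        · have hμT : μ ∈ T := by
            simpa [hTdef] using ⟨hμ, hasEigenvalue_of_hasEigenvector ⟨hy, hy0⟩⟩
          obtain ⟨c, rfl⟩ := hsimple μ hμ (v μ) y (hv μ hμT).2
            (mem_eigenspace_iff.mp (hv μ hμT).1) (mem_eigenspace_iff.mp hy)
          have h1 := huv μ hμT
          rw [hpr, inner_add_right, hr (v μ) (hvG μ hμT), add_zero] at h1
          rw [inner_smul_left, h1, mul_zero]
    rw [ContinuousLinearMap.orthogonalComplement_iSup_eigenspaces_eq_bot hc hA,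
      Submodule.mem_bot] at hp0
    rw [hpr, hp0, zero_add]
    exact hr
  rw [Submodule.orthogonal_orthogonal_eq_closure] at huG
  have hclosed : IsClosed {y : E | inner ℝ (A y) y ≤ s * ‖y‖ ^ 2} :=
    isClosed_le (by fun_prop) (by fun_prop)
  have := closure_minimal (fun y hy => inner_le_of_mem_iSup_eigenspace hA hy) hclosed huG
  exact absurd (hφ x hx0) (not_lt.mpr this)

end Counting

/-! ### Operators with a self-similar quadratic form -/

section SelfSimilarOperator

open Module End

variable {E : Type*} [NormedAddCommGroup E] [InnerProductSpace ℝ E] {κ : Type*}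

/-- The abstract form of the self-similarity of the weight. The functionals `⟪e k, ·⟫` are the
evaluations at the nodes, `w k` is a bump at the `k`-th node, `ζ k` the mass of the weight there,
`J` transplants a function to the `m`-th interval, where `a` and `d` are the scaling factors, and
`R` undoes this. On functions vanishing at all nodes the form of `A` is `d` times the form of the
rescaled functions. -/
structure SelfSimilarOp [DecidableEq κ] (A : E →L[ℝ] E) (e w : κ → E) (ζ : κ → ℝ) (a d : ℝ)
    (J R : E →L[ℝ] E) : Prop where
  symm : A.IsSymmetric
  inner_bump : ∀ i j, inner ℝ (e i) (w j) = if i = j then 1 else 0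
  form_bump : ∀ y k, inner ℝ (A y) (w k) = -ζ k * inner ℝ (e k) y
  inner_J : ∀ k u, inner ℝ (e k) (J u) = 0
  R_J : ∀ u, R (J u) = u
  norm_J : ∀ u, ‖u‖ ^ 2 = a * ‖J u‖ ^ 2
  norm_R : ∀ v, ‖R v‖ ^ 2 ≤ a * ‖v‖ ^ 2
  form_R : ∀ v v', (∀ k, inner ℝ (e k) v = 0) → (∀ k, inner ℝ (e k) v' = 0) →
    inner ℝ (A v) v' = d * inner ℝ (A (R v)) (R v')
  a_pos : 0 < a
  d_pos : 0 < d
  ad_lt_one : a * d < 1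

namespace SelfSimilarOp

variable {A : E →L[ℝ] E} {e w : κ → E} {ζ : κ → ℝ} {a d : ℝ} {J R : E →L[ℝ] E}

/-- With `Q` the orthogonal projection onto the functions vanishing at the nodes, `A` differs from
`Q A Q = d (R Q)† A (R Q)` by an operator of finite rank. As `‖R Q‖² ≤ a` and `a d < 1`, iterating
this approximates `A` by compact operators. -/
theorem isCompactOperator_aux [CompleteSpace E] [Fintype κ]
    (norm_R : ∀ v, ‖R v‖ ^ 2 ≤ a * ‖v‖ ^ 2)
    (form_R : ∀ v v', (∀ k, inner ℝ (e k) v = 0) → (∀ k, inner ℝ (e k) v' = 0) →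
      inner ℝ (A v) v' = d * inner ℝ (A (R v)) (R v'))
    (ha : 0 < a) (hd : 0 < d) (had : a * d < 1) : IsCompactOperator A := by
  set W : Submodule ℝ E := Submodule.span ℝ (Set.range e) with hW
  have : FiniteDimensional ℝ W := FiniteDimensional.span_of_finite ℝ (Set.finite_range e)
  set S : E →L[ℝ] E := W.starProjection with hS
  set Q : E →L[ℝ] E := 1 - S with hQ
  have hScomp : IsCompactOperator S := by
    have h1 : IsCompactOperator W.orthogonalProjectionOnto :=
      have : ProperSpace W := FiniteDimensional.proper ℝ W
      isCompactOperator_of_locallyCompactSpace_dom W.orthogonalProjectionOnto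
    exact h1.clm_comp W.subtypeL
  have hQe : ∀ y k, inner ℝ (e k) (Q y) = 0 := by
    intro y k
    have : Q y ∈ Wᗮ := by
      simp [hQ, hS, W.sub_starProjection_mem_orthogonal y]
    exact this _ (Submodule.subset_span ⟨k, rfl⟩)
  have hSsymm : ∀ x y, inner ℝ (S x) y = inner ℝ x (S y) :=
    fun x y => W.inner_starProjection_left_eq_right x y
  have hQsymm : ∀ x y, inner ℝ (Q x) y = inner ℝ x (Q y) := by
    intro x y
    simp [hQ, inner_sub_left, inner_sub_right, hSsymm]
  have hQnorm : ∀ y, ‖Q y‖ ≤ ‖y‖ := by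
    intro y
    have h1 : inner ℝ (Q y) (S y) = 0 := by
      have h2 : Q y ∈ Wᗮ := by
        simp [hQ, hS, W.sub_starProjection_mem_orthogonal y]
      exact Submodule.inner_left_of_mem_orthogonal (W.starProjection_apply_mem y) h2
    have h2 : y = Q y + S y := by simp [hQ]
    have h3 : ‖y‖ ^ 2 = ‖Q y‖ ^ 2 + ‖S y‖ ^ 2 := by
      conv_lhs => rw [h2]
      rw [norm_add_sq_real, h1]; ring
    exact pow_le_pow_iff_left₀ (norm_nonneg _) (norm_nonneg _) two_ne_zero |>.mp (by
      nlinarith [sq_nonneg ‖S y‖])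
  set T : E →L[ℝ] E := R ∘L Q with hT
  have hTnorm : ‖T‖ ^ 2 ≤ a := by
    have h1 : ‖T‖ ≤ √a := by
      refine T.opNorm_le_bound (Real.sqrt_nonneg _) fun y => ?_
      have h2 := norm_R (Q y)
      have h3 := hQnorm y
      refine (pow_le_pow_iff_left₀ (norm_nonneg _) (by positivity) two_ne_zero).mp ?_
      rw [mul_pow, Real.sq_sqrt ha.le]
      refine h2.trans ?_
      gcongr
    calc ‖T‖ ^ 2 ≤ √a ^ 2 := by gcongr
      _ = a := Real.sq_sqrt ha.le
  set Td := ContinuousLinearMap.adjoint T with hTd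
  have hQAQ : ∀ y, Q (A (Q y)) = d • Td (A (T y)) := by
    intro y
    refine ext_inner_right ℝ fun z => ?_
    rw [hQsymm, form_R _ _ (hQe y) (hQe z), inner_smul_left, hTd,
      ContinuousLinearMap.adjoint_inner_left]
    rfl
  set F : E →L[ℝ] E := S ∘L A + Q ∘L A ∘L S with hF
  have hFcomp : IsCompactOperator F :=
    (hScomp.comp_clm A).add (hScomp.clm_comp (Q ∘L A))
  have hAF : ∀ K : E →L[ℝ] E, A - (F + d • (Td ∘L K ∘L T)) = d • (Td ∘L (A - K) ∘L T) := by
    intro K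
    ext y
    have h1 : A y = F y + Q (A (Q y)) := by
      simp [hF, hQ]
      abel
    simp only [sub_apply, add_apply,
      smul_apply, ContinuousLinearMap.comp_apply]
    rw [h1, hQAQ, map_sub, smul_sub]
    abel
  have hstep : ∀ j : ℕ, ∃ K : E →L[ℝ] E, IsCompactOperator K ∧ ‖A - K‖ ≤ (a * d) ^ j * ‖A‖ := by
    intro j
    induction j with
    | zero => exact ⟨0, isCompactOperator_zero, by simp⟩
    | succ j ih =>
      obtain ⟨K, hK, hKn⟩ := ih
      refine ⟨F + d • (Td ∘L K ∘L T), hFcomp.add (((hK.comp_clm T).clm_comp Td).smul d), ?_⟩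
      rw [hAF, norm_smul, Real.norm_of_nonneg hd.le]
      have h1 : ‖Td ∘L (A - K) ∘L T‖ ≤ ‖T‖ ^ 2 * ‖A - K‖ := by
        refine (ContinuousLinearMap.opNorm_comp_le _ _).trans ?_
        have h2 : ‖Td‖ = ‖T‖ := LinearIsometryEquiv.norm_map _ _
        rw [h2, sq, mul_assoc]
        refine mul_le_mul_of_nonneg_left ?_ (norm_nonneg _)
        rw [mul_comm]
        exact ContinuousLinearMap.opNorm_comp_le _ _
      calc d * ‖Td ∘L (A - K) ∘L T‖ ≤ d * (‖T‖ ^ 2 * ‖A - K‖) := by gcongr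
        _ ≤ d * (a * ((a * d) ^ j * ‖A‖)) := by gcongr
        _ = (a * d) ^ (j + 1) * ‖A‖ := by ring
  choose K hK hKn using hstep
  refine isCompactOperator_of_tendsto (l := atTop) (F := K) ?_ (Eventually.of_forall hK)
  rw [tendsto_iff_norm_sub_tendsto_zero]
  have h0 : Tendsto (fun j : ℕ => (a * d) ^ j * ‖A‖) atTop (nhds 0) := by
    simpa using (tendsto_pow_atTop_nhds_zero_of_lt_one (by positivity) had).mul_const ‖A‖
  refine squeeze_zero (fun _ => norm_nonneg _) (fun j => ?_) h0
  rw [norm_sub_rev]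
  exact hKn j

theorem isCompactOperator [CompleteSpace E] [Fintype κ] [DecidableEq κ]
    (h : SelfSimilarOp A e w ζ a d J R) : IsCompactOperator A :=
  isCompactOperator_aux h.norm_R h.form_R h.a_pos h.d_pos h.ad_lt_one

/-- On functions vanishing at all nodes the form of `A` is `d` times that of the rescaled functions,
while rescaling multiplies squared norms by at most `a`; so the conditions at the nodes raise the
level from `s` to `s / (a d)`. -/
theorem hasPosDim_step [Fintype κ] [DecidableEq κ]
    (h : SelfSimilarOp A e w ζ a d J R) {s : ℝ} (hs : 0 ≤ s) {k : ℕ}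
    (hk : HasPosDim A s (k + Fintype.card κ)) : HasPosDim A (s / (a * d)) k := by
  refine hk.of_conditions le_rfl (fun i => (innerSL ℝ (e i) : E →ₗ[ℝ] ℝ)) (R : E →ₗ[ℝ] E) ?_
  intro u hu hpos
  have ha := h.a_pos
  have hd := h.d_pos
  rw [h.form_R u u hu hu] at hpos
  have h1 : s * ‖R u‖ ^ 2 ≤ a * (s * ‖u‖ ^ 2) := by nlinarith [h.norm_R u]
  change s / (a * d) * ‖R u‖ ^ 2 < inner ℝ (A (R u)) (R u)
  rw [div_mul_eq_mul_div, div_lt_iff₀ (by positivity)]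
  nlinarith

/-- Since no level above `‖A‖` is reached, iterating the rescaling bounds the dimension of a
positive subspace at every positive level. -/
theorem exists_not_hasPosDim [Fintype κ] [DecidableEq κ]
    (h : SelfSimilarOp A e w ζ a d J R) {s : ℝ} (hs : 0 < s) :
    ∃ N, ¬ HasPosDim A s N := by
  have ha := h.a_pos
  have hd := h.d_pos
  have hbig : ∀ t, ‖A‖ < t → ¬ HasPosDim A t 1 := by
    rintro t ht ⟨φ, hφ⟩
    have h1 := hφ (fun _ => 1) (fun h0 => by simpa using congrFun h0 0)
    have h2 := real_inner_le_norm (A (φ fun _ => 1)) (φ fun _ => 1)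
    have h3 := A.le_opNorm (φ fun _ => 1)
    nlinarith [norm_nonneg (φ fun _ => 1), sq_nonneg ‖φ fun _ => 1‖]
  have hind : ∀ j : ℕ, ∀ t, 0 < t → ‖A‖ * (a * d) ^ j < t →
      ¬ HasPosDim A t (1 + j * Fintype.card κ) := by
    intro j
    induction j with
    | zero => intro t _ ht; simpa using hbig t (by simpa using ht)
    | succ j ih =>
      intro t ht0 ht hP
      refine ih (t / (a * d)) (by positivity) ?_ (h.hasPosDim_step ht0.le (by
        rwa [add_assoc, ← Nat.succ_mul]))
      rw [lt_div_iff₀ (by positivity)]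
      calc _ = ‖A‖ * (a * d) ^ (j + 1) := by ring
        _ < t := ht
  have h0 : Tendsto (fun j : ℕ => ‖A‖ * (a * d) ^ j) atTop (nhds 0) := by
    simpa using (tendsto_pow_atTop_nhds_zero_of_lt_one (by positivity) h.ad_lt_one).const_mul ‖A‖
  obtain ⟨j, hj⟩ := (h0.eventually (gt_mem_nhds hs)).exists
  exact ⟨_, hind j s hs hj⟩

/-- The form on combinations of bumps is diagonal. -/
theorem form_sum_bump [DecidableEq κ]
    (h : SelfSimilarOp A e w ζ a d J R) (I : Finset κ) (c : κ → ℝ) :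
    inner ℝ (A (∑ i ∈ I, c i • w i)) (∑ i ∈ I, c i • w i) = ∑ i ∈ I, -ζ i * c i ^ 2 := by
  rw [inner_sum]
  refine Finset.sum_congr rfl fun i hi => ?_
  rw [inner_smul_right, h.form_bump, inner_sum, Finset.sum_eq_single i]
  · rw [inner_smul_right, h.inner_bump]; simp; ring
  · intro j _ hne
    rw [inner_smul_right, h.inner_bump, if_neg hne.symm, mul_zero]
  · exact fun h => absurd hi h

/-- The bumps are orthogonal, with respect to the form, to the functions vanishing at all nodes. -/
theorem form_vanish_bump [DecidableEq κ]
    (h : SelfSimilarOp A e w ζ a d J R) {v : E}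
    (hv : ∀ k, inner ℝ (e k) v = 0) (I : Finset κ) (c : κ → ℝ) :
    inner ℝ (A v) (∑ i ∈ I, c i • w i) = 0 := by
  rw [inner_sum]
  refine Finset.sum_eq_zero fun i _ => ?_
  rw [inner_smul_right, h.form_bump, hv, mul_zero, mul_zero]

theorem form_add_bump [DecidableEq κ]
    (h : SelfSimilarOp A e w ζ a d J R) {v : E}
    (hv : ∀ k, inner ℝ (e k) v = 0) (I : Finset κ) (c : κ → ℝ) :
    inner ℝ (A (v + ∑ i ∈ I, c i • w i)) (v + ∑ i ∈ I, c i • w i)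
      = inner ℝ (A v) v + ∑ i ∈ I, -ζ i * c i ^ 2 := by
  have h1 := h.form_vanish_bump hv I c
  have h2 : inner ℝ (A (∑ i ∈ I, c i • w i)) v = 0 := by
    rw [h.symm.apply_clm, real_inner_comm]
    exact h1
  rw [map_add, inner_add_left, inner_add_right, inner_add_right, h1, h2, h.form_sum_bump]
  ring

/-- A uniform lower bound for the masses in terms of the norm of a combination of bumps. -/
theorem exists_bump_bound [Fintype κ] (w : κ → E) (hζ : ∀ k, ζ k ≠ 0) :
    ∃ γ > 0, ∀ (I : Finset κ) (c : κ → ℝ),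
      γ * ‖∑ i ∈ I, c i • w i‖ ^ 2 ≤ ∑ i ∈ I, |ζ i| * c i ^ 2 := by
  classical
  obtain ⟨δ, hδ, hδζ⟩ : ∃ δ > 0, ∀ k, δ ≤ |ζ k| := by
    rcases isEmpty_or_nonempty κ with hκ | hκ
    · exact ⟨1, one_pos, fun k => (hκ.false k).elim⟩
    · obtain ⟨k₀, hk₀⟩ := Finite.exists_min fun k => |ζ k|
      exact ⟨|ζ k₀|, abs_pos.mpr (hζ k₀), hk₀⟩
  set M : ℝ := 1 + ∑ i, ‖w i‖ ^ 2 with hM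
  have hMpos : 0 < M := by
    have : 0 ≤ ∑ i, ‖w i‖ ^ 2 := Finset.sum_nonneg fun i _ => sq_nonneg _
    linarith
  refine ⟨δ / M, by positivity, fun I c => ?_⟩
  have h1 : ‖∑ i ∈ I, c i • w i‖ ^ 2 ≤ (∑ i ∈ I, c i ^ 2) * M := by
    calc ‖∑ i ∈ I, c i • w i‖ ^ 2 ≤ (∑ i ∈ I, |c i| * ‖w i‖) ^ 2 := by
          gcongr
          refine (norm_sum_le _ _).trans (le_of_eq ?_)
          simp [norm_smul]
      _ ≤ (∑ i ∈ I, |c i| ^ 2) * ∑ i ∈ I, ‖w i‖ ^ 2 := Finset.sum_mul_sq_le_sq_mul_sq _ _ _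
      _ ≤ (∑ i ∈ I, c i ^ 2) * M := by
          simp only [sq_abs]
          refine mul_le_mul_of_nonneg_left ?_ (Finset.sum_nonneg fun i _ => sq_nonneg _)
          have := Finset.sum_le_sum_of_subset_of_nonneg (Finset.subset_univ I)
            (fun i _ _ => sq_nonneg ‖w i‖)
          linarith
  calc δ / M * ‖∑ i ∈ I, c i • w i‖ ^ 2 ≤ δ / M * ((∑ i ∈ I, c i ^ 2) * M) := by gcongr
    _ = ∑ i ∈ I, δ * c i ^ 2 := by rw [← Finset.mul_sum]; field_simp
    _ ≤ ∑ i ∈ I, |ζ i| * c i ^ 2 :=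
        Finset.sum_le_sum fun i _ => mul_le_mul_of_nonneg_right (hδζ i) (sq_nonneg _)

/-- Spectral quasi-periodicity: near zero, the count at level `s` exceeds the count at level
`s / (a d)` by the number `Z` of negative masses, up to a relative shift of order `s` in the
level. -/
theorem exists_hasPosDim_bounds [Fintype κ] [DecidableEq κ]
    (h : SelfSimilarOp A e w ζ a d J R) (hζ : ∀ k, ζ k ≠ 0) {Z : ℕ}
    (hZ : Z = Fintype.card {k // ζ k < 0}) :
    ∃ C > 0, ∃ s₀ > 0, ∀ s, 0 < s → s < s₀ → ∀ k,
      (HasPosDim A (s * (1 + C * s) / (a * d)) k → HasPosDim A s (k + Z)) ∧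
      (HasPosDim A s (k + Z) → HasPosDim A (s * (1 - C * s) / (a * d)) k) := by
  obtain ⟨γ, hγ, hbump⟩ := exists_bump_bound w hζ
  have ha := h.a_pos
  have hd := h.d_pos
  refine ⟨2 / γ, by positivity, γ / 4, by positivity, fun s hs hs₀ k => ⟨?_, ?_⟩⟩
  -- the transplanted subspace and the `Z` bumps at the negative masses span a positive subspace:
  -- they are orthogonal for the form, but not for the inner product, which costs the factor
  -- `1 + C s` in the level
  · rintro ⟨φ, hφ⟩
    set I : Finset κ := Finset.univ.filter (ζ · < 0) with hI
    refine HasPosDim.of_le_finrank (X := (Fin k → ℝ) × ({k // ζ k < 0} → ℝ)) (by simp [hZ])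
      (LinearMap.coprod ((J : E →ₗ[ℝ] E) ∘ₗ φ)
        (Fintype.linearCombination ℝ (fun i : {k // ζ k < 0} => w i))) ?_
    rintro ⟨x, c⟩ hxc
    set c' : κ → ℝ := fun i => if hi : ζ i < 0 then c ⟨i, hi⟩ else 0 with hc'
    have hsum : Fintype.linearCombination ℝ (fun i : {k // ζ k < 0} => w i) c
        = ∑ i ∈ I, c' i • w i := by
      rw [Fintype.linearCombination_apply, hI, Finset.sum_filter, ← Finset.sum_filter,
        ← Finset.sum_subtype_eq_sum_filter, Finset.subtype_univ]
      refine Finset.sum_congr rfl fun i _ => ?_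
      simp [hc', i.2]
    rw [LinearMap.coprod_apply, hsum]
    change s * ‖J (φ x) + ∑ i ∈ I, c' i • w i‖ ^ 2
      < inner ℝ (A (J (φ x) + ∑ i ∈ I, c' i • w i)) (J (φ x) + ∑ i ∈ I, c' i • w i)
    rw [h.form_add_bump (fun k => h.inner_J k _)]
    have hform : inner ℝ (A (J (φ x))) (J (φ x)) = d * inner ℝ (A (φ x)) (φ x) := by
      rw [h.form_R _ _ (fun k => h.inner_J k _) (fun k => h.inner_J k _), h.R_J]
    have hmass : ∑ i ∈ I, -ζ i * c' i ^ 2 = ∑ i ∈ I, |ζ i| * c' i ^ 2 := by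
      refine Finset.sum_congr rfl fun i hi => ?_
      rw [abs_of_neg (by simpa [hI] using hi)]
    have hb := hbump I c'
    rw [hform, hmass, norm_add_sq_real]
    set v := J (φ x) with hv
    set y := ∑ i ∈ I, c' i • w i with hy
    have hcs := abs_real_inner_le_norm v y
    have hcs' := neg_abs_le (inner ℝ v y)
    have hcs'' := le_abs_self (inner ℝ v y)
    have hvn : s * (1 + 2 / γ * s) * ‖v‖ ^ 2 ≤ d * inner ℝ (A (φ x)) (φ x) := by
      have h1 : s * (1 + 2 / γ * s) / (a * d) * ‖φ x‖ ^ 2 ≤ inner ℝ (A (φ x)) (φ x) := by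
        by_cases hx : x = 0
        · simp [hx]
        · exact (hφ x hx).le
      rw [h.norm_J (φ x)] at h1
      calc s * (1 + 2 / γ * s) * ‖v‖ ^ 2
          = d * (s * (1 + 2 / γ * s) / (a * d) * (a * ‖v‖ ^ 2)) := by field_simp
        _ ≤ _ := by gcongr
    -- completing the square absorbs the mixed term `2 s ⟪v, y⟫`
    have hsq : 2 * s * (‖v‖ * ‖y‖) ≤ 2 / γ * s ^ 2 * ‖v‖ ^ 2 + γ / 2 * ‖y‖ ^ 2 := by
      have : 0 ≤ γ / 2 * (‖y‖ - 2 / γ * s * ‖v‖) ^ 2 := by positivity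
      have h2 : γ / 2 * (‖y‖ - 2 / γ * s * ‖v‖) ^ 2
          = γ / 2 * ‖y‖ ^ 2 - 2 * s * (‖v‖ * ‖y‖) + 2 / γ * s ^ 2 * ‖v‖ ^ 2 := by
        field_simp
        ring
      linarith
    have hsv : s * inner ℝ v y ≤ s * (‖v‖ * ‖y‖) := by
      gcongr
      linarith
    -- strictness comes from the bumps if `y ≠ 0`, and otherwise from the transplanted function
    by_cases hy0 : y = 0
    · have hc0 : c = 0 := by
        funext i
        have h1 : inner ℝ (e i) y = c' i := by
          rw [hy, inner_sum, Finset.sum_eq_single i.1]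
          · rw [inner_smul_right, h.inner_bump]; simp
          · intro j _ hne
            rw [inner_smul_right, h.inner_bump, if_neg hne.symm, mul_zero]
          · intro hi
            exact absurd (by simpa [hI] using i.2) hi
        rw [hy0, inner_zero_right] at h1
        have h2 : c' i = c i := by simp [hc', i.2]
        rw [← h2, ← h1]; rfl
      have hx0 : x ≠ 0 := fun hx => hxc (by rw [hx, hc0]; rfl)
      have h1 := hφ x hx0
      rw [h.norm_J (φ x)] at h1
      have h3 : s * (1 + 2 / γ * s) * ‖v‖ ^ 2 < d * inner ℝ (A (φ x)) (φ x) := by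
        calc s * (1 + 2 / γ * s) * ‖v‖ ^ 2
            = d * (s * (1 + 2 / γ * s) / (a * d) * (a * ‖v‖ ^ 2)) := by field_simp
          _ < _ := by gcongr
      rw [hy0, inner_zero_right, norm_zero]
      rw [hy0, norm_zero] at hb
      have h4 : 0 ≤ s * (2 / γ * s) * ‖v‖ ^ 2 := by positivity
      nlinarith
    · have hyn : 0 < ‖y‖ ^ 2 := by positivity
      nlinarith
  · intro hP
    -- a positive function vanishing at the nodes of negative mass is corrected by bumps to vanish
    -- at the other nodes too, which increases the form by at least `γ ‖y‖ ^ 2`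
    set I : Finset κ := Finset.univ.filter (0 < ζ ·) with hI
    set B : E →ₗ[ℝ] E :=
      LinearMap.id - ∑ i ∈ I, (innerSL ℝ (e i) : E →ₗ[ℝ] ℝ).smulRight (w i) with hBdef
    have hBdefv : ∀ u, B u = u - ∑ i ∈ I, inner ℝ (e i) u • w i := by
      intro u; simp [hBdef]
    refine hP.of_conditions hZ.ge (fun i : {k // ζ k < 0} => (innerSL ℝ (e i) : E →ₗ[ℝ] ℝ))
      ((R : E →ₗ[ℝ] E) ∘ₗ B) ?_
    intro u hu hpos
    set v := B u with hv
    set y := ∑ i ∈ I, inner ℝ (e i) u • w i with hy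
    have huv : u = v + y := by rw [hv, hBdefv]; simp [hy]
    have hve : ∀ k, inner ℝ (e k) v = 0 := by
      intro k
      rw [hv, hBdefv, inner_sub_right, inner_sum]
      simp only [inner_smul_right, h.inner_bump]
      rcases lt_or_gt_of_ne (hζ k) with hk | hk
      · rw [hu ⟨k, hk⟩ |> (fun h => (h : inner ℝ (e k) u = 0))]
        rw [Finset.sum_eq_zero, sub_zero]
        intro i hi
        have : k ≠ i := by
          rintro rfl
          have : 0 < ζ k := by simpa [hI] using hi
          linarith
        rw [if_neg this, mul_zero]
      · rw [Finset.sum_eq_single k]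
        · simp
        · intro i _ hne
          rw [if_neg hne.symm, mul_zero]
        · intro hk'
          exact absurd (by simpa [hI] using hk) hk'
    have hform := h.form_add_bump hve I (fun i => inner ℝ (e i) u)
    have hmass : ∑ i ∈ I, -ζ i * (inner ℝ (e i) u) ^ 2
        = -∑ i ∈ I, |ζ i| * (inner ℝ (e i) u) ^ 2 := by
      rw [← Finset.sum_neg_distrib]
      refine Finset.sum_congr rfl fun i hi => ?_
      rw [abs_of_pos (by simpa [hI] using hi)]
      ring
    have hb := hbump I (fun i => inner ℝ (e i) u)
    simp only [← hy] at hform hb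
    rw [huv, hform, hmass, norm_add_sq_real] at hpos
    have hcs := abs_real_inner_le_norm v y
    have hcs' := neg_abs_le (inner ℝ v y)
    have hsq : 2 * s * (‖v‖ * ‖y‖) ≤ s ^ 2 / γ * ‖v‖ ^ 2 + γ * ‖y‖ ^ 2 := by
      have : 0 ≤ γ * (‖y‖ - s / γ * ‖v‖) ^ 2 := by positivity
      have h2 : γ * (‖y‖ - s / γ * ‖v‖) ^ 2
          = γ * ‖y‖ ^ 2 - 2 * s * (‖v‖ * ‖y‖) + s ^ 2 / γ * ‖v‖ ^ 2 := by
        field_simp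
        ring
      linarith
    have hsv : -(s * (‖v‖ * ‖y‖)) ≤ s * inner ℝ v y := by
      rw [← mul_neg]
      gcongr
      linarith
    have hAv : s * (1 - 2 / γ * s) * ‖v‖ ^ 2 < inner ℝ (A v) v := by
      have h1 : s * (1 - 2 / γ * s) * ‖v‖ ^ 2
          = s * ‖v‖ ^ 2 - 2 * (s ^ 2 / γ * ‖v‖ ^ 2) := by ring
      have h2 : 0 ≤ s ^ 2 / γ * ‖v‖ ^ 2 := by positivity
      have h3 : 0 ≤ s * ‖y‖ ^ 2 := by positivity
      nlinarith
    rw [h.form_R v v hve hve] at hAv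
    have hpos' : 0 ≤ s * (1 - 2 / γ * s) := by
      have : 2 / γ * s ≤ 1 := by
        rw [div_mul_eq_mul_div, div_le_one hγ]
        linarith
      exact mul_nonneg hs.le (by linarith)
    have h1 : s * (1 - 2 / γ * s) * ‖R v‖ ^ 2 ≤ s * (1 - 2 / γ * s) * (a * ‖v‖ ^ 2) :=
      mul_le_mul_of_nonneg_left (h.norm_R v) hpos'
    change s * (1 - 2 / γ * s) / (a * d) * ‖R v‖ ^ 2 < inner ℝ (A (R v)) (R v)
    rw [div_mul_eq_mul_div, div_lt_iff₀ (by positivity)]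
    nlinarith

end SelfSimilarOp

end SelfSimilarOperator

/-! ### From quasi-periodic counting functions to asymptotics -/

section Sequences

variable {p : ℝ → Prop}

theorem ncard_lt_of_lt (hfin : ∀ s, 0 < s → {t | s < t ∧ p t}.Finite) {s t : ℝ} (hs : 0 < s)
    (hst : s < t) (ht : p t) : {u | t < u ∧ p u}.ncard < {u | s < u ∧ p u}.ncard := by
  refine Set.ncard_lt_ncard ⟨fun u hu => ⟨hst.trans hu.1, hu.2⟩, fun hsub => ?_⟩ (hfin s hs)
  exact lt_irrefl t (hsub ⟨hst, ht⟩ : t ∈ {u | t < u ∧ p u}).1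

/-- The least element above `s` has one element fewer above it. -/
theorem exists_next (hfin : ∀ s, 0 < s → {t | s < t ∧ p t}.Finite) {s : ℝ} (hs : 0 < s) {k : ℕ}
    (hk : {t | s < t ∧ p t}.ncard = k + 1) :
    ∃ t, s < t ∧ p t ∧ {u | t < u ∧ p u}.ncard = k := by
  have hne : {t | s < t ∧ p t}.Nonempty := by
    rw [← Set.ncard_pos (hfin s hs)]; omega
  obtain ⟨t, ht, hmin⟩ := (hfin s hs).exists_minimal hne
  refine ⟨t, ht.1, ht.2, ?_⟩
  have hdiff : {u | t < u ∧ p u} = {u | s < u ∧ p u} \ {t} := by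
    ext u
    simp only [Set.mem_ofPred_eq, Set.mem_sdiff, Set.mem_singleton_iff]
    refine ⟨fun hu => ⟨⟨ht.1.trans hu.1, hu.2⟩, hu.1.ne'⟩, fun hu => ⟨?_, hu.1.2⟩⟩
    rcases lt_trichotomy u t with h | h | h
    · exact absurd (hmin hu.1 h.le) (not_le.mpr h)
    · exact absurd h hu.2
    · exact h
  rw [hdiff, Set.ncard_sdiff_singleton_of_mem ht, hk]
  rfl

theorem exists_rank_eq (hfin : ∀ s, 0 < s → {t | s < t ∧ p t}.Finite) (j i : ℕ) :
    ∀ s, 0 < s → {t | s < t ∧ p t}.ncard = j + i + 1 →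
      ∃ t, s < t ∧ p t ∧ {u | t < u ∧ p u}.ncard = j := by
  induction i with
  | zero => exact fun s hs h => exists_next hfin hs h
  | succ i ih =>
    intro s hs h
    obtain ⟨t, hst, _, ht⟩ := exists_next hfin hs h
    obtain ⟨u, htu, hu⟩ := ih t (hs.trans hst) ht
    exact ⟨u, hst.trans htu, hu⟩

/-- A set of positive numbers with finite tails `(s, ∞)` and unbounded counting function is the
range of a strictly decreasing sequence. -/
theorem exists_strictAnti_enumeration (hfin : ∀ s, 0 < s → {t | s < t ∧ p t}.Finite)
    (hunb : ∀ k, ∃ s, 0 < s ∧ k ≤ {t | s < t ∧ p t}.ncard) :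
    ∃ ν : ℕ → ℝ, StrictAnti ν ∧ Set.range ν = {t | 0 < t ∧ p t} ∧
      ∀ s, 0 < s → ∀ j, s < ν j ↔ j + 1 ≤ {t | s < t ∧ p t}.ncard := by
  have hex : ∀ j, ∃ t, 0 < t ∧ p t ∧ {u | t < u ∧ p u}.ncard = j := by
    intro j
    obtain ⟨s, hs, hj⟩ := hunb (j + 1)
    obtain ⟨i, hi⟩ := Nat.exists_eq_add_of_le hj
    obtain ⟨t, hst, ht⟩ := exists_rank_eq hfin j i s hs (by omega)
    exact ⟨t, hs.trans hst, ht⟩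
  choose ν hν0 hνp hνj using hex
  refine ⟨ν, fun i j hij => ?_, ?_, fun s hs j => ⟨fun h => ?_, fun h => ?_⟩⟩
  · by_contra! hle
    rcases hle.eq_or_lt with h | h
    · have h1 := hνj i
      rw [h, hνj j] at h1
      omega
    · have h1 := ncard_lt_of_lt hfin (hν0 i) h (hνp j)
      rw [hνj, hνj] at h1
      omega
  · ext t
    refine ⟨?_, fun ht => ⟨{u | t < u ∧ p u}.ncard, ?_⟩⟩
    · rintro ⟨j, rfl⟩
      exact ⟨hν0 j, hνp j⟩
    · set j := {u | t < u ∧ p u}.ncard with hj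
      rcases lt_trichotomy (ν j) t with h | h | h
      · have h1 := ncard_lt_of_lt hfin (hν0 j) h ht.2
        rw [hνj] at h1
        omega
      · exact h
      · have h1 := ncard_lt_of_lt hfin ht.1 h (hνp j)
        rw [hνj] at h1
        omega
  · have h1 := ncard_lt_of_lt hfin hs h (hνp j)
    rwa [hνj] at h1
  · by_contra! hle
    have h1 : {u | s < u ∧ p u}.ncard ≤ {u | ν j < u ∧ p u}.ncard :=
      Set.ncard_le_ncard (fun u hu => ⟨hle.trans_lt hu.1, hu.2⟩) (hfin _ (hν0 j))
    rw [hνj] at h1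
    exact absurd (h.trans h1) (by omega)

/-- A null sequence that is geometric up to relative errors of its own order is asymptotic to a
geometric sequence: the logarithm of `x k / q ^ k` has summable increments. -/
theorem exists_tendsto_div_pow {x : ℕ → ℝ} {q C : ℝ} (hq : 0 < q) (hq1 : q < 1)
    (hx : ∀ k, 0 < x k) (hx0 : Tendsto x atTop (nhds 0))
    (hstep : ∀ᶠ k in atTop, |q * x k - x (k + 1)| ≤ C * x (k + 1) ^ 2) :
    ∃ m > 0, Tendsto (fun k => x k / q ^ k) atTop (nhds m) := by
  -- any ratio strictly between `q` and `1` would do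
  set r := (1 + q) / 2 with hr
  have hr0 : 0 < r := by positivity
  have hqr : q < r := by rw [hr]; linarith
  have hx1 : Tendsto (fun k => C * x (k + 1)) atTop (nhds 0) := by
    simpa using (hx0.comp (tendsto_add_atTop_nat 1)).const_mul C
  have hhalf : ∀ᶠ k in atTop, C * x (k + 1) < 1 / 2 :=
    hx1.eventually (gt_mem_nhds (by norm_num))
  have hsmall : ∀ᶠ k in atTop, C * x (k + 1) < 1 - q / r :=
    hx1.eventually (gt_mem_nhds (by rw [sub_pos, div_lt_one hr0]; exact hqr))
  -- the error term is eventually small, so that `x` decays geometrically with ratio `r`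
  have hsum : Summable x := by
    refine summable_of_ratio_norm_eventually_le (r := r) (by rw [hr]; linarith) ?_
    filter_upwards [hstep, hsmall] with k h1 h2
    rw [Real.norm_of_nonneg (hx _).le, Real.norm_of_nonneg (hx _).le]
    have h3 := (abs_le.mp h1).1
    have h4 : x (k + 1) * (q / r) ≤ q * x k := by
      nlinarith [hx (k + 1)]
    have h5 : x (k + 1) * (q / r) * r = q * x (k + 1) := by field_simp
    have h6 : q * x (k + 1) ≤ q * (r * x k) := by nlinarith
    exact le_of_mul_le_mul_left h6 hq
  set z : ℕ → ℝ := fun k => Real.log (x k / q ^ k) with hz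
  have hdist : ∀ᶠ k in atTop, dist (z k) (z (k + 1)) ≤ 2 * C * x (k + 1) := by
    filter_upwards [hstep, hhalf] with k h1 h2
    set ρ := q * x k / x (k + 1) with hρ
    have hx1 := hx (k + 1)
    have hzz : z k - z (k + 1) = Real.log ρ := by
      have hxk := hx k
      rw [hz]
      simp only
      rw [← Real.log_div (by positivity) (by positivity)]
      congr 1
      rw [hρ]
      field_simp
      ring
    have hρ1 : |ρ - 1| ≤ C * x (k + 1) := by
      have : ρ - 1 = (q * x k - x (k + 1)) / x (k + 1) := by
        rw [hρ]; field_simp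
      rw [this, abs_div, abs_of_pos hx1, div_le_iff₀ hx1]
      linarith
    obtain ⟨h3, h4⟩ := abs_le.mp hρ1
    have hρ0 : 1 / 2 ≤ ρ := by linarith
    have hρpos : 0 < ρ := by linarith
    rw [Real.dist_eq, hzz, abs_le]
    constructor
    · refine le_trans ?_ (Real.one_sub_inv_le_log_of_pos hρpos)
      have : 1 - ρ⁻¹ = (ρ - 1) / ρ := by field_simp
      rw [this, le_div_iff₀ hρpos]
      nlinarith
    · have := Real.log_le_sub_one_of_pos hρpos
      nlinarith
  have hcauchy : CauchySeq z := by
    refine cauchySeq_of_summable_dist ?_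
    refine Summable.of_norm_bounded_eventually_nat
      (((summable_nat_add_iff 1).mpr hsum).mul_left (2 * C)) ?_
    filter_upwards [hdist] with k hk
    rwa [Real.norm_of_nonneg dist_nonneg]
  obtain ⟨L, hL⟩ := cauchySeq_tendsto_of_complete hcauchy
  refine ⟨Real.exp L, Real.exp_pos L, ?_⟩
  refine ((Real.continuous_exp.tendsto L).comp hL).congr fun k => ?_
  have := hx k
  exact Real.exp_log (by positivity)

/-- A set of positive numbers whose counting function `N` satisfies
`N (s (1 + C s) / q) + Z ≤ N s ≤ N (s (1 - C s) / q) + Z` for small `s` splits into `Z` sequences,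
each asymptotic to a multiple of `q ^ k`. -/
theorem exists_enumeration_of_quasiPeriodic {q C s₀ : ℝ} (hq : 0 < q) (hq1 : q < 1) (hC : 0 < C)
    (hs₀ : 0 < s₀) (hCs₀ : C * s₀ ≤ 1) {Z : ℕ} (hZ : 0 < Z)
    (hfin : ∀ s, 0 < s → {t | s < t ∧ p t}.Finite)
    (hlow : ∀ s, 0 < s → s < s₀ →
      {t | s * (1 + C * s) / q < t ∧ p t}.ncard + Z ≤ {t | s < t ∧ p t}.ncard)
    (hup : ∀ s, 0 < s → s < s₀ →
      {t | s < t ∧ p t}.ncard ≤ {t | s * (1 - C * s) / q < t ∧ p t}.ncard + Z) :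
    ∃ ν : ℕ → ℝ, StrictAnti ν ∧ Set.range ν = {t | 0 < t ∧ p t} ∧
      ∀ j, ∃ m > 0, Tendsto (fun k => ν (j + k * Z) / q ^ k) atTop (nhds m) := by
  have hunb : ∀ k, ∃ s, 0 < s ∧ k ≤ {t | s < t ∧ p t}.ncard := by
    intro k
    induction k with
    | zero => exact ⟨1, one_pos, Nat.zero_le _⟩
    | succ k ih =>
      obtain ⟨s, hs, hk⟩ := ih
      have h0 : Tendsto (fun u : ℝ => u * (1 + C * u) / q) (nhds 0) (nhds 0) := by
        have : Continuous fun u : ℝ => u * (1 + C * u) / q := by fun_prop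
        simpa using this.tendsto 0
      obtain ⟨u, hu, hus₀, hu0⟩ := ((h0.eventually (gt_mem_nhds hs)).filter_mono
        nhdsWithin_le_nhds |>.and (((gt_mem_nhds hs₀).filter_mono nhdsWithin_le_nhds).and
          (self_mem_nhdsWithin (s := Set.Ioi (0 : ℝ))))).exists
      have hu0 : 0 < u := hu0
      refine ⟨u, hu0, ?_⟩
      have h1 := hlow u hu0 hus₀
      have h2 : {t | s < t ∧ p t}.ncard ≤ {t | u * (1 + C * u) / q < t ∧ p t}.ncard :=
        Set.ncard_le_ncard (fun t ht => ⟨hu.trans ht.1, ht.2⟩) (hfin _ (by positivity))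
      omega
  obtain ⟨ν, hanti, hrange, hcount⟩ := exists_strictAnti_enumeration hfin hunb
  have hνpos : ∀ j, 0 < ν j := fun j =>
    (hrange ▸ Set.mem_range_self j : ν j ∈ {t | 0 < t ∧ p t}).1
  have hν0 : Tendsto ν atTop (nhds 0) := by
    rw [tendsto_order]
    refine ⟨fun b hb => Eventually.of_forall fun j => hb.trans (hνpos j), fun s hs => ?_⟩
    filter_upwards [eventually_ge_atTop {t | s / 2 < t ∧ p t}.ncard] with j hj
    by_contra! h
    have := (hcount (s / 2) (by linarith) j).mp (by linarith)
    omega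
  refine ⟨ν, hanti, hrange, fun j => ?_⟩
  have hsub : Tendsto (fun k => j + k * Z) atTop atTop :=
    tendsto_atTop_mono (fun k => (Nat.le_mul_of_pos_right k hZ).trans (Nat.le_add_left _ j))
      tendsto_id
  refine exists_tendsto_div_pow (x := fun k => ν (j + k * Z)) (C := C) hq hq1 (fun k => hνpos _)
    (hν0.comp hsub) ?_
  have hev : ∀ᶠ k in atTop, ν (j + (k + 1) * Z) < s₀ :=
    ((hν0.comp hsub).comp (tendsto_add_atTop_nat 1)).eventually (gt_mem_nhds hs₀)
  filter_upwards [hev] with k hk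
  have hidx : j + (k + 1) * Z = j + k * Z + Z := by ring
  rw [hidx] at hk ⊢
  set i := j + k * Z with hi
  set s := ν (i + Z) with hs
  have hs0 : 0 < s := hνpos _
  have h1 : q * ν i ≤ s * (1 + C * s) := by
    by_contra! h
    have h2 : s * (1 + C * s) / q < ν i := by rwa [div_lt_iff₀ hq, mul_comm (ν i)]
    have h3 := (hcount _ (by positivity) _).mp h2
    have h4 := hlow s hs0 hk
    exact lt_irrefl s ((hcount s hs0 (i + Z)).mpr (by omega))
  have h2 : s * (1 - C * s) ≤ q * ν i := by
    -- `s` itself is not counted at level `s`, so the upper bound is used at levels `u` below `s`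
    have h3 : ∀ᶠ u in nhdsWithin s (Set.Iio s), u * (1 - C * u) ≤ q * ν i := by
      filter_upwards [self_mem_nhdsWithin,
        (lt_mem_nhds hs0).filter_mono nhdsWithin_le_nhds] with u hu hu0
      have hu : u < s := hu
      have hu0 : 0 < u := hu0
      have h4 := (hcount u hu0 (i + Z)).mp hu
      have h5 := hup u hu0 (hu.trans hk)
      have hCu : C * u < 1 := by nlinarith
      have hlev : 0 < u * (1 - C * u) / q := div_pos (mul_pos hu0 (by linarith)) hq
      have h6 := (hcount _ hlev i).mpr (by omega)
      rw [div_lt_iff₀ hq] at h6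
      linarith
    refine le_of_tendsto (f := fun u : ℝ => u * (1 - C * u)) ?_ h3
    have : Continuous fun u : ℝ => u * (1 - C * u) := by fun_prop
    exact (this.tendsto s).mono_left nhdsWithin_le_nhds
  rw [abs_le]
  constructor <;> nlinarith

/-- The asymptotics in terms of `l = -1 / t`, enumerated from `1` on. -/
theorem exists_negative_enumeration {q C s₀ : ℝ} (hq : 0 < q) (hq1 : q < 1) (hC : 0 < C)
    (hs₀ : 0 < s₀) (hCs₀ : C * s₀ ≤ 1) {Z : ℕ} (hZ : 0 < Z)
    (hfin : ∀ s, 0 < s → {t | s < t ∧ p t}.Finite)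
    (hlow : ∀ s, 0 < s → s < s₀ →
      {t | s * (1 + C * s) / q < t ∧ p t}.ncard + Z ≤ {t | s < t ∧ p t}.ncard)
    (hup : ∀ s, 0 < s → s < s₀ →
      {t | s < t ∧ p t}.ncard ≤ {t | s * (1 - C * s) / q < t ∧ p t}.ncard + Z) :
    ∃ lam : ℕ → ℝ, StrictAntiOn lam (Set.Ici 1) ∧
      lam '' Set.Ici 1 = {l : ℝ | l < 0 ∧ p (-l⁻¹)} ∧
      ∃ μ : ℕ → ℝ, ∀ l, 1 ≤ l → 0 < μ l ∧
        (fun k : ℕ => lam (l + k * Z)) ~[atTop] (fun k : ℕ => -μ l * q ^ (-(k : ℤ))) := by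
  obtain ⟨ν, hanti, hrange, hlim⟩ :=
    exists_enumeration_of_quasiPeriodic hq hq1 hC hs₀ hCs₀ hZ hfin hlow hup
  have hνpos : ∀ j, 0 < ν j := fun j =>
    (hrange ▸ Set.mem_range_self j : ν j ∈ {t | 0 < t ∧ p t}).1
  choose m hm0 hm using hlim
  refine ⟨fun k => -(ν (k - 1))⁻¹, ?_, ?_, fun l => (m (l - 1))⁻¹, fun l hl => ⟨?_, ?_⟩⟩
  · intro i hi j hj hij
    have hi : 1 ≤ i := hi
    have h1 : ν (j - 1) < ν (i - 1) := hanti (by omega)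
    have := inv_strictAnti₀ (hνpos _) h1
    simp only
    linarith
  · ext l
    constructor
    · rintro ⟨k, hk, rfl⟩
      have h1 : ν (k - 1) ∈ {t | 0 < t ∧ p t} := hrange ▸ Set.mem_range_self _
      refine ⟨by simpa using h1.1, ?_⟩
      simpa using h1.2
    · rintro ⟨hl, hp⟩
      have h1 : -l⁻¹ ∈ Set.range ν := by
        rw [hrange]
        exact ⟨by simpa using hl, hp⟩
      obtain ⟨j, hj⟩ := h1
      refine ⟨j + 1, by simp, ?_⟩
      simp [hj]
  · exact inv_pos.mpr (hm0 _)
  · have h1 : (fun k => ν (l - 1 + k * Z)) ~[atTop] fun k => m (l - 1) * q ^ k := by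
      rw [isEquivalent_iff_tendsto_one
        (Eventually.of_forall fun k => (mul_pos (hm0 _) (pow_pos hq k)).ne')]
      have h2 := (hm (l - 1)).div_const (m (l - 1))
      rw [div_self (hm0 _).ne'] at h2
      refine h2.congr fun k => ?_
      simp only [Pi.div_apply]
      field_simp
    have h2 := h1.inv.neg
    refine (h2.congr_left ?_).congr_right ?_
    · refine Eventually.of_forall fun k => ?_
      have : l + k * Z - 1 = l - 1 + k * Z := by omega
      simp [this]
    · refine Eventually.of_forall fun k => ?_
      simp [mul_comm]

end Sequences

/-- Spectral asymptotics for an operator with a self-similar form and simple positive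
eigenvalues. -/
theorem SelfSimilarOp.exists_eigenvalue_asymptotics {E : Type*} [NormedAddCommGroup E]
    [InnerProductSpace ℝ E] [CompleteSpace E] {κ : Type*} [Fintype κ] [DecidableEq κ]
    {A : E →L[ℝ] E} {e w : κ → E} {ζ : κ → ℝ} {a d : ℝ} {J R : E →L[ℝ] E}
    (h : SelfSimilarOp A e w ζ a d J R) (hζ : ∀ k, ζ k ≠ 0) {Z : ℕ}
    (hZ : Z = Fintype.card {k // ζ k < 0}) (hZpos : 0 < Z)
    (hsimple : ∀ t : ℝ, 0 < t → ∀ x y, x ≠ 0 → A x = t • x → A y = t • y → ∃ c : ℝ, y = c • x) :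
    ∃ lam : ℕ → ℝ, StrictAntiOn lam (Set.Ici 1) ∧
      lam '' Set.Ici 1
        = {l : ℝ | l < 0 ∧ Module.End.HasEigenvalue (A : Module.End ℝ E) (-l⁻¹)} ∧
      ∃ μ : ℕ → ℝ, ∀ l, 1 ≤ l → 0 < μ l ∧
        (fun k : ℕ => lam (l + k * Z)) ~[atTop] (fun k : ℕ => -μ l * (a * d) ^ (-(k : ℤ))) := by
  have hfin : ∀ s, 0 < s →
      {t | s < t ∧ Module.End.HasEigenvalue (A : Module.End ℝ E) t}.Finite := by
    intro s hs
    obtain ⟨N, hN⟩ := h.exists_not_hasPosDim hs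
    exact finite_eigenvalues_of_not_hasPosDim h.symm hN
  have hcount : ∀ s, 0 < s → ∀ k, HasPosDim A s k ↔
      k ≤ {t | s < t ∧ Module.End.HasEigenvalue (A : Module.End ℝ E) t}.ncard := fun s hs k =>
    hasPosDim_iff_le_ncard h.symm h.isCompactOperator (fun t ht => hsimple t (hs.trans ht))
      (hfin s hs) k
  obtain ⟨C, hC, s₀, hs₀, hb⟩ := h.exists_hasPosDim_bounds hζ hZ
  have ha := h.a_pos
  have hd := h.d_pos
  -- `s₀ ≤ 1 / C` keeps the levels `s * (1 - C * s) / (a * d)` positive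
  refine exists_negative_enumeration (q := a * d) (C := C) (s₀ := min s₀ (1 / C)) (by positivity)
    h.ad_lt_one hC (by positivity) ?_ hZpos hfin ?_ ?_
  · calc C * min s₀ (1 / C) ≤ C * (1 / C) := by gcongr; exact min_le_right _ _
      _ = 1 := by field_simp
  · intro s hs hss
    refine (hcount s hs _).mp ((hb s hs (hss.trans_le (min_le_left _ _)) _).1 ?_)
    exact (hcount _ (by positivity) _).mpr le_rfl
  · intro s hs hss
    have hCs : C * s < 1 := by
      have := hss.trans_le (min_le_right _ _)
      rwa [lt_div_iff₀ hC, mul_comm] at this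
    have hlev : 0 < s * (1 - C * s) / (a * d) :=
      div_pos (mul_pos hs (by linarith)) (by positivity)
    by_contra! hlt
    obtain ⟨i, hi⟩ := Nat.exists_eq_add_of_lt hlt
    have h1 := (hcount s hs ({t | s * (1 - C * s) / (a * d) < t ∧
      Module.End.HasEigenvalue (A : Module.End ℝ E) t}.ncard + 1 + Z)).mpr (by omega)
    have h2 := (hcount _ hlev _).mp ((hb s hs (hss.trans_le (min_le_left _ _)) _).2 h1)
    omega

/-! ### Primitives of square-integrable functions -/

/-- Lebesgue measure on the unit interval. -/
noncomputable abbrev unitMeasure : Measure ℝ := volume.restrict (Set.Ioc 0 1)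

/-- The primitive of `f` vanishing at `0`. -/
noncomputable def prim (f : ℝ → ℝ) (x : ℝ) : ℝ := ∫ t in (0 : ℝ)..x, f t

/-- The derivative of `prim f * prim g`. -/
noncomputable def dprod (f g : ℝ → ℝ) (x : ℝ) : ℝ := f x * prim g x + prim f x * g x

theorem dprod_comm (f g : ℝ → ℝ) (x : ℝ) : dprod f g x = dprod g f x := by
  unfold dprod; ring

@[simp] theorem prim_zero (f : ℝ → ℝ) : prim f 0 = 0 := by simp [prim]

theorem intervalIntegrable_of_integrable {f : ℝ → ℝ} (hf : Integrable f unitMeasure) {u v : ℝ}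
    (hu : u ∈ Set.Icc (0 : ℝ) 1) (hv : v ∈ Set.Icc (0 : ℝ) 1) :
    IntervalIntegrable f volume u v := by
  have h : IntervalIntegrable f volume 0 1 :=
    (intervalIntegrable_iff_integrableOn_Ioc_of_le zero_le_one).mpr hf
  refine h.mono_set ?_
  rw [Set.uIcc_of_le zero_le_one]
  exact Set.uIcc_subset_Icc hu hv

theorem ae_restrict_uIoc {p : ℝ → Prop} (h : ∀ᵐ x ∂unitMeasure, p x) {u v : ℝ}
    (hu : u ∈ Set.Icc (0 : ℝ) 1) (hv : v ∈ Set.Icc (0 : ℝ) 1) :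
    ∀ᵐ x, x ∈ Set.uIoc u v → p x := by
  rw [ae_restrict_iff' measurableSet_Ioc] at h
  filter_upwards [h] with x hx hxu
  exact hx ⟨(le_min hu.1 hv.1).trans_lt hxu.1, hxu.2.trans (max_le hu.2 hv.2)⟩

theorem prim_congr {f g : ℝ → ℝ} (h : f =ᵐ[unitMeasure] g) {x : ℝ} (hx : x ∈ Set.Icc (0 : ℝ) 1) :
    prim f x = prim g x :=
  intervalIntegral.integral_congr_ae (ae_restrict_uIoc h ⟨le_rfl, zero_le_one⟩ hx)

section Integrable

variable {f g : ℝ → ℝ} (hf : Integrable f unitMeasure) (hg : Integrable g unitMeasure)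

include hf

theorem prim_sub_prim {u v : ℝ} (hu : u ∈ Set.Icc (0 : ℝ) 1) (hv : v ∈ Set.Icc (0 : ℝ) 1) :
    ∫ x in u..v, f x = prim f v - prim f u :=
  (intervalIntegral.integral_interval_sub_left
    (intervalIntegrable_of_integrable hf ⟨le_rfl, zero_le_one⟩ hv)
    (intervalIntegrable_of_integrable hf ⟨le_rfl, zero_le_one⟩ hu)).symm

theorem absolutelyContinuous_prim : AbsolutelyContinuousOnInterval (prim f) 0 1 :=
  (intervalIntegrable_of_integrable hf ⟨le_rfl, zero_le_one⟩
    ⟨zero_le_one, le_rfl⟩).absolutelyContinuousOnInterval_intervalIntegral (c := 0) (by simp)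

theorem continuousOn_prim : ContinuousOn (prim f) (Set.Icc 0 1) := by
  simpa [Set.uIcc_of_le zero_le_one] using (absolutelyContinuous_prim hf).continuousOn

theorem ae_hasDerivAt_prim : ∀ᵐ x ∂unitMeasure, HasDerivAt (prim f) (f x) x := by
  rw [ae_restrict_iff' measurableSet_Ioc]
  have h := (intervalIntegrable_of_integrable hf (u := 0) (v := 1) ⟨le_rfl, zero_le_one⟩
    ⟨zero_le_one, le_rfl⟩).ae_hasDerivAt_integral
  filter_upwards [h] with x hx hx1
  rw [Set.uIcc_of_le zero_le_one] at hx
  exact hx (Set.Ioc_subset_Icc_self hx1) 0 ⟨le_rfl, zero_le_one⟩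

theorem ae_deriv_prim : deriv (prim f) =ᵐ[unitMeasure] f := by
  filter_upwards [ae_hasDerivAt_prim hf] with x hx using hx.deriv

theorem exists_prim_bound : ∃ C, ∀ x ∈ Set.Icc (0 : ℝ) 1, |prim f x| ≤ C :=
  isCompact_Icc.exists_bound_of_continuousOn (continuousOn_prim hf)

theorem aestronglyMeasurable_prim : AEStronglyMeasurable (prim f) unitMeasure :=
  ((continuousOn_prim hf).mono Set.Ioc_subset_Icc_self).aestronglyMeasurable measurableSet_Ioc

theorem memLp_top_prim : MemLp (prim f) ⊤ unitMeasure := by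
  obtain ⟨C, hC⟩ := exists_prim_bound hf
  refine memLp_top_of_bound (aestronglyMeasurable_prim hf) C ?_
  filter_upwards [ae_restrict_mem measurableSet_Ioc] with x hx
  exact hC x (Set.Ioc_subset_Icc_self hx)

include hg

/-- Integration by parts. -/
theorem integral_dprod {u v : ℝ} (hu : u ∈ Set.Icc (0 : ℝ) 1) (hv : v ∈ Set.Icc (0 : ℝ) 1) :
    ∫ x in u..v, dprod f g x = prim f v * prim g v - prim f u * prim g u := by
  have hsub : Set.uIcc u v ⊆ Set.uIcc 0 1 := by
    rw [Set.uIcc_of_le (zero_le_one (α := ℝ))]; exact Set.uIcc_subset_Icc hu hv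
  rw [← AbsolutelyContinuousOnInterval.integral_deriv_mul_eq_sub
    ((absolutelyContinuous_prim hf).mono hsub) ((absolutelyContinuous_prim hg).mono hsub)]
  refine intervalIntegral.integral_congr_ae ?_
  filter_upwards [ae_restrict_uIoc (ae_deriv_prim hf) hu hv,
    ae_restrict_uIoc (ae_deriv_prim hg) hu hv] with x h1 h2 hx
  rw [dprod, h1 hx, h2 hx]

end Integrable

section SquareIntegrable

variable {P f g : ℝ → ℝ}

theorem integrable_of_memLp_two (hf : MemLp f 2 unitMeasure) :
    Integrable f unitMeasure := hf.integrable one_le_two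

theorem memLp_mul_prim (hP : MemLp P 2 unitMeasure) (hg : MemLp g 2 unitMeasure) :
    MemLp (fun x => P x * prim g x) 2 unitMeasure :=
  (memLp_top_prim (integrable_of_memLp_two hg)).mul hP

theorem integrable_mul_dprod (hP : MemLp P 2 unitMeasure) (hf : MemLp f 2 unitMeasure)
    (hg : MemLp g 2 unitMeasure) : Integrable (fun x => P x * dprod f g x) unitMeasure := by
  have h1 := (memLp_mul_prim hP hg).integrable_mul hf
  have h2 := (memLp_mul_prim hP hf).integrable_mul hg
  refine (h1.add h2).congr (Eventually.of_forall fun x => ?_)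
  simp only [Pi.add_apply, Pi.mul_apply, dprod]
  ring

/-- Where `P` is constant, the form only depends on the boundary values. -/
theorem integral_mul_dprod_of_const (hf : MemLp f 2 unitMeasure) (hg : MemLp g 2 unitMeasure)
    {c u v : ℝ} (hu : 0 ≤ u) (huv : u ≤ v) (hv : v ≤ 1)
    (hP : ∀ᵐ x, x ∈ Set.Ioo u v → P x = c) :
    ∫ x in u..v, P x * dprod f g x = c * (prim f v * prim g v - prim f u * prim g u) := by
  rw [← integral_dprod (integrable_of_memLp_two hf) (integrable_of_memLp_two hg) ⟨hu, huv.trans hv⟩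
    ⟨hu.trans huv, hv⟩, ← intervalIntegral.integral_const_mul]
  refine intervalIntegral.integral_congr_ae ?_
  have hne : ∀ᵐ x : ℝ, x ≠ v := by simp [ae_iff]
  filter_upwards [hP, hne] with x hx hxv hxu
  rw [Set.uIoc_of_le huv] at hxu
  rw [hx ⟨hxu.1, lt_of_le_of_ne hxu.2 hxv⟩]

end SquareIntegrable

/-! ### The energy space and the operator of the form -/

/-- The Hilbert space of derivatives of real functions in the Sobolev space: square-integrable
functions on the unit interval with mean zero. A function `y` of the Sobolev space corresponds to
`f = y'`, and `y = prim f`. -/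
noncomputable abbrev EnergySpace : Submodule ℝ (Lp ℝ 2 unitMeasure) :=
  (Submodule.span ℝ {Lp.const 2 unitMeasure (1 : ℝ)})ᗮ

theorem inner_eq_integral (f g : Lp ℝ 2 unitMeasure) :
    inner ℝ f g = ∫ x in (0 : ℝ)..1, f x * g x := by
  rw [L2.inner_def, intervalIntegral.integral_of_le zero_le_one]
  simp [mul_comm]

theorem mem_energySpace_iff (f : Lp ℝ 2 unitMeasure) :
    f ∈ EnergySpace ↔ prim f 1 = 0 := by
  rw [Submodule.mem_orthogonal_singleton_iff_inner_right, inner_eq_integral, prim]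
  have : ∫ x in (0 : ℝ)..1, Lp.const 2 unitMeasure (1 : ℝ) x * f x = ∫ x in (0 : ℝ)..1, f x := by
    refine intervalIntegral.integral_congr_ae ?_
    filter_upwards [ae_restrict_uIoc (Lp.coeFn_const (p := 2) (μ := unitMeasure) (1 : ℝ))
      ⟨le_rfl, zero_le_one⟩ ⟨zero_le_one, le_rfl⟩] with x hx hx1
    rw [hx hx1]; simp
  rw [this]

/-- The element of the energy space given by a square-integrable function with mean zero. -/
noncomputable def EnergySpace.mk (f : ℝ → ℝ) (hf : MemLp f 2 unitMeasure) (h0 : prim f 1 = 0) :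
    EnergySpace :=
  ⟨hf.toLp f, by
    rw [mem_energySpace_iff, prim_congr hf.coeFn_toLp ⟨zero_le_one, le_rfl⟩, h0]⟩

theorem EnergySpace.coe_mk {f : ℝ → ℝ} (hf : MemLp f 2 unitMeasure) (h0 : prim f 1 = 0) :
    ((EnergySpace.mk f hf h0 : EnergySpace) : Lp ℝ 2 unitMeasure) =ᵐ[unitMeasure] f :=
  hf.coeFn_toLp

theorem EnergySpace.ext_ae {f g : EnergySpace}
    (h : (f : Lp ℝ 2 unitMeasure) =ᵐ[unitMeasure] (g : Lp ℝ 2 unitMeasure)) : f = g :=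
  Subtype.ext (Lp.ext h)

theorem EnergySpace.memLp (f : EnergySpace) : MemLp (f : Lp ℝ 2 unitMeasure) 2 unitMeasure :=
  Lp.memLp _

theorem EnergySpace.integrable (f : EnergySpace) :
    Integrable (f : Lp ℝ 2 unitMeasure) unitMeasure := integrable_of_memLp_two (EnergySpace.memLp f)

theorem EnergySpace.prim_one (f : EnergySpace) : prim (f : Lp ℝ 2 unitMeasure) 1 = 0 :=
  (mem_energySpace_iff _).mp f.2

theorem EnergySpace.inner_eq (f g : EnergySpace) :
    inner ℝ f g = ∫ x in (0 : ℝ)..1, (f : Lp ℝ 2 unitMeasure) x * (g : Lp ℝ 2 unitMeasure) x :=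
  inner_eq_integral _ _

theorem EnergySpace.norm_sq_eq (f : EnergySpace) :
    ‖f‖ ^ 2 = ∫ x in (0 : ℝ)..1, (f : Lp ℝ 2 unitMeasure) x ^ 2 := by
  rw [← real_inner_self_eq_norm_sq, EnergySpace.inner_eq]
  simp only [sq]

/-- The Riesz representative of the evaluation `f ↦ prim f c`. -/
noncomputable def EnergySpace.eval (c : ℝ) : EnergySpace :=
  EnergySpace.orthogonalProjectionOnto
    (indicatorConstLp 2 (measurableSet_Ioc (a := (0 : ℝ)) (b := c)) (measure_ne_top unitMeasure _)
      (1 : ℝ))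

theorem inner_indicator_eq_prim (f : Lp ℝ 2 unitMeasure) {c : ℝ} (hc : c ∈ Set.Icc (0 : ℝ) 1) :
    inner ℝ (indicatorConstLp 2 (measurableSet_Ioc (a := (0 : ℝ)) (b := c))
      (measure_ne_top unitMeasure _) (1 : ℝ)) f = prim f c := by
  rw [L2.inner_indicatorConstLp_one, prim, intervalIntegral.integral_of_le hc.1,
    Measure.restrict_restrict measurableSet_Ioc,
    Set.inter_eq_left.mpr (Set.Ioc_subset_Ioc_right hc.2)]

theorem EnergySpace.inner_eval (f : EnergySpace) {c : ℝ} (hc : c ∈ Set.Icc (0 : ℝ) 1) :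
    inner ℝ (EnergySpace.eval c) f = prim (f : Lp ℝ 2 unitMeasure) c := by
  rw [← inner_indicator_eq_prim _ hc, EnergySpace.eval]
  exact Submodule.inner_orthogonalProjectionOnto_eq_of_mem_right f _

theorem abs_prim_le_norm (f : Lp ℝ 2 unitMeasure) {c : ℝ} (hc : c ∈ Set.Icc (0 : ℝ) 1) :
    |prim f c| ≤ ‖f‖ := by
  rw [← inner_indicator_eq_prim f hc]
  refine (abs_real_inner_le_norm _ _).trans ?_
  have h1 : ‖indicatorConstLp 2 (measurableSet_Ioc (a := (0 : ℝ)) (b := c))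
      (measure_ne_top unitMeasure _) (1 : ℝ)‖ ≤ 1 := by
    refine (norm_indicatorConstLp_le).trans ?_
    simp only [norm_one, one_mul]
    refine Real.rpow_le_one measureReal_nonneg ?_ (by positivity)
    refine (measureReal_mono (Set.subset_univ _)).trans ?_
    simp [measureReal_def]
  nlinarith [norm_nonneg f]

/-- The form `∫ P (y z)'` for `y = prim f`, `z = prim g`. -/
noncomputable def weightForm (P f g : ℝ → ℝ) : ℝ := ∫ x in (0 : ℝ)..1, P x * dprod f g x

theorem weightForm_comm (P f g : ℝ → ℝ) : weightForm P f g = weightForm P g f := by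
  simp only [weightForm, dprod_comm f g]

theorem weightForm_congr {P f f' g g' : ℝ → ℝ} (hf : f =ᵐ[unitMeasure] f')
    (hg : g =ᵐ[unitMeasure] g') : weightForm P f g = weightForm P f' g' := by
  refine intervalIntegral.integral_congr_ae ?_
  filter_upwards [ae_restrict_uIoc hf ⟨le_rfl, zero_le_one⟩ ⟨zero_le_one, le_rfl⟩,
    ae_restrict_uIoc hg ⟨le_rfl, zero_le_one⟩ ⟨zero_le_one, le_rfl⟩] with x h1 h2 hx
  have hx' : x ∈ Set.Icc (0 : ℝ) 1 := by
    rw [Set.uIoc_of_le zero_le_one] at hx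
    exact Set.Ioc_subset_Icc_self hx
  rw [dprod, dprod, h1 hx, h2 hx, prim_congr hf hx', prim_congr hg hx']

theorem weightForm_add_left {P f f' g : ℝ → ℝ} (hP : MemLp P 2 unitMeasure)
    (hf : MemLp f 2 unitMeasure) (hf' : MemLp f' 2 unitMeasure) (hg : MemLp g 2 unitMeasure) :
    weightForm P (fun x => f x + f' x) g = weightForm P f g + weightForm P f' g := by
  have h0 : (0 : ℝ) ∈ Set.Icc (0 : ℝ) 1 := ⟨le_rfl, zero_le_one⟩
  have h1 : (1 : ℝ) ∈ Set.Icc (0 : ℝ) 1 := ⟨zero_le_one, le_rfl⟩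
  unfold weightForm
  rw [← intervalIntegral.integral_add
    (intervalIntegrable_of_integrable (integrable_mul_dprod hP hf hg) h0 h1)
    (intervalIntegrable_of_integrable (integrable_mul_dprod hP hf' hg) h0 h1)]
  refine intervalIntegral.integral_congr fun x hx => ?_
  rw [Set.uIcc_of_le zero_le_one] at hx
  have : prim (fun x => f x + f' x) x = prim f x + prim f' x :=
    intervalIntegral.integral_add
      (intervalIntegrable_of_integrable (integrable_of_memLp_two hf) h0 hx)
      (intervalIntegrable_of_integrable (integrable_of_memLp_two hf') h0 hx)
  simp only [dprod, this]
  ring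

theorem weightForm_smul_left (P f g : ℝ → ℝ) (c : ℝ) :
    weightForm P (fun x => c * f x) g = c * weightForm P f g := by
  unfold weightForm
  rw [← intervalIntegral.integral_const_mul]
  have : ∀ x, prim (fun x => c * f x) x = c * prim f x := fun x =>
    intervalIntegral.integral_const_mul _ _
  simp only [dprod, this]
  congr 1
  funext x
  ring

theorem abs_integral_mul_le (P f : Lp ℝ 2 unitMeasure) :
    ∫ x, |P x * f x| ∂unitMeasure ≤ ‖P‖ * ‖f‖ := by
  have h1 : ∫ x, |P x * f x| ∂unitMeasure = inner ℝ |P| |f| := by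
    rw [L2.inner_def]
    refine integral_congr_ae ?_
    filter_upwards [Lp.coeFn_abs P, Lp.coeFn_abs f] with x h1 h2
    rw [h1, h2, abs_mul]
    simp [mul_comm]
  rw [h1]
  refine (real_inner_le_norm _ _).trans ?_
  rw [norm_abs_eq_norm, norm_abs_eq_norm]

theorem abs_weightForm_le (P f g : Lp ℝ 2 unitMeasure) :
    |weightForm P f g| ≤ 2 * ‖P‖ * ‖f‖ * ‖g‖ := by
  have hP := Lp.memLp P
  have hf := Lp.memLp f
  have hg := Lp.memLp g
  rw [weightForm, intervalIntegral.integral_of_le zero_le_one]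
  refine (abs_integral_le_integral_abs).trans ?_
  have h1 : Integrable (fun x => |P x * f x|) unitMeasure := (hP.integrable_mul hf).abs
  have h2 : Integrable (fun x => |P x * g x|) unitMeasure := (hP.integrable_mul hg).abs
  calc ∫ x, |P x * dprod f g x| ∂unitMeasure
      ≤ ∫ x, (‖g‖ * |P x * f x| + ‖f‖ * |P x * g x|) ∂unitMeasure := by
        refine integral_mono_ae (integrable_mul_dprod hP hf hg).abs
          ((h1.const_mul _).add (h2.const_mul _)) ?_
        filter_upwards [ae_restrict_mem measurableSet_Ioc] with x hx
        have hx' := Set.Ioc_subset_Icc_self hx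
        have e : P x * dprod f g x = prim g x * (P x * f x) + prim f x * (P x * g x) := by
          rw [dprod]; ring
        rw [e]
        refine (abs_add_le _ _).trans ?_
        rw [abs_mul, abs_mul (prim f x)]
        have h3 := abs_prim_le_norm g hx'
        have h4 := abs_prim_le_norm f hx'
        gcongr
    _ = ‖g‖ * ∫ x, |P x * f x| ∂unitMeasure + ‖f‖ * ∫ x, |P x * g x| ∂unitMeasure := by
        rw [integral_add (h1.const_mul _) (h2.const_mul _), integral_const_mul, integral_const_mul]
    _ ≤ ‖g‖ * (‖P‖ * ‖f‖) + ‖f‖ * (‖P‖ * ‖g‖) := by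
        gcongr
        · exact abs_integral_mul_le P f
        · exact abs_integral_mul_le P g
    _ = _ := by ring

theorem weightForm_coe_add (P : Lp ℝ 2 unitMeasure) (f f' g : EnergySpace) :
    weightForm P ((f + f' : EnergySpace) : Lp ℝ 2 unitMeasure) (g : Lp ℝ 2 unitMeasure)
      = weightForm P (f : Lp ℝ 2 unitMeasure) (g : Lp ℝ 2 unitMeasure)
        + weightForm P (f' : Lp ℝ 2 unitMeasure) (g : Lp ℝ 2 unitMeasure) := by
  rw [← weightForm_add_left (Lp.memLp P) (Lp.memLp _) (Lp.memLp _) (Lp.memLp _)]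
  exact weightForm_congr (Lp.coeFn_add _ _) ae_eq_rfl

theorem weightForm_coe_smul (P : Lp ℝ 2 unitMeasure) (c : ℝ) (f g : EnergySpace) :
    weightForm P ((c • f : EnergySpace) : Lp ℝ 2 unitMeasure) (g : Lp ℝ 2 unitMeasure)
      = c * weightForm P (f : Lp ℝ 2 unitMeasure) (g : Lp ℝ 2 unitMeasure) := by
  rw [← weightForm_smul_left]
  exact weightForm_congr (Lp.coeFn_smul _ _) ae_eq_rfl

/-- `weightForm` as a bounded bilinear form on the energy space. -/
noncomputable def weightBilin (P : Lp ℝ 2 unitMeasure) :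
    EnergySpace →L[ℝ] EnergySpace →L[ℝ] ℝ :=
  (LinearMap.mk₂ ℝ (fun f g : EnergySpace =>
      weightForm P (f : Lp ℝ 2 unitMeasure) (g : Lp ℝ 2 unitMeasure))
    (fun f f' g => weightForm_coe_add P f f' g)
    (fun c f g => weightForm_coe_smul P c f g)
    (fun f g g' => by
      rw [weightForm_comm, weightForm_coe_add, weightForm_comm, weightForm_comm P g'])
    (fun c f g => by
      rw [weightForm_comm, weightForm_coe_smul, weightForm_comm]; rfl)).mkContinuous₂ (2 * ‖P‖)
    (fun f g => abs_weightForm_le P f g)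

/-- The operator representing the form `∫ P (y z)'` on the energy space. -/
noncomputable def weightOp (P : Lp ℝ 2 unitMeasure) : EnergySpace →L[ℝ] EnergySpace :=
  InnerProductSpace.continuousLinearMapOfBilin (𝕜 := ℝ) (weightBilin P)

theorem inner_weightOp (P : Lp ℝ 2 unitMeasure) (f g : EnergySpace) :
    inner ℝ (weightOp P f) g
      = weightForm P (f : Lp ℝ 2 unitMeasure) (g : Lp ℝ 2 unitMeasure) :=
  InnerProductSpace.continuousLinearMapOfBilin_apply (𝕜 := ℝ) (weightBilin P) f g

theorem weightOp_isSymmetric (P : Lp ℝ 2 unitMeasure) : (weightOp P).IsSymmetric := by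
  intro f g
  change inner ℝ (weightOp P f) g = inner ℝ f (weightOp P g)
  rw [inner_weightOp, real_inner_comm, inner_weightOp, weightForm_comm]

/-! ### Transplantation to a subinterval -/

theorem zero_mem_unit : (0 : ℝ) ∈ Set.Icc (0 : ℝ) 1 := ⟨le_rfl, zero_le_one⟩

theorem one_mem_unit : (1 : ℝ) ∈ Set.Icc (0 : ℝ) 1 := ⟨zero_le_one, le_rfl⟩

theorem ae_comp_affine {p : ℝ → Prop} (h : ∀ᵐ x, p x) {c : ℝ} (hc : c ≠ 0) (b : ℝ) :
    ∀ᵐ x, p (c * (x - b)) := by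
  have h1 : Measure.QuasiMeasurePreserving (fun x : ℝ => x - b) volume volume :=
    (measurePreserving_sub_right volume b).quasiMeasurePreserving
  have h2 : Measure.QuasiMeasurePreserving (fun x : ℝ => c * x) volume volume :=
    Measure.quasiMeasurePreserving_smul volume hc
  exact (h2.comp h1).ae h

/-- The derivative of `y (a⁻¹ (x - α))` on `(α, α + a]`, extended by zero, where `y' = f`. -/
noncomputable def transplant (α a : ℝ) (f : ℝ → ℝ) (x : ℝ) : ℝ :=
  (Set.Ioc α (α + a)).indicator (fun x => a⁻¹ * f (a⁻¹ * (x - α))) x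

section Transplant

variable {α a : ℝ}

theorem transplant_affine (ha : 0 < a) (f : ℝ → ℝ) {t : ℝ} (ht : t ∈ Set.Ioc (0 : ℝ) 1) :
    transplant α a f (a * t + α) = a⁻¹ * f t := by
  have hmem : a * t + α ∈ Set.Ioc α (α + a) := by
    constructor <;> nlinarith [ht.1, ht.2]
  rw [transplant, Set.indicator_of_mem hmem]
  congr 2
  field_simp
  ring

theorem integral_transplant_mul (hα : 0 ≤ α) (ha : 0 < a) (hαa : α + a ≤ 1) (f F : ℝ → ℝ) :
    ∫ x in (0 : ℝ)..1, transplant α a f x * F x = ∫ t in (0 : ℝ)..1, f t * F (a * t + α) := by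
  have h1 : ∀ x, transplant α a f x * F x
      = (Set.Ioc α (α + a)).indicator (fun x => a⁻¹ * f (a⁻¹ * (x - α)) * F x) x := by
    intro x
    rw [transplant, Set.indicator_mul_left (f := fun x => a⁻¹ * f (a⁻¹ * (x - α)))]
  simp only [h1]
  rw [intervalIntegral.integral_of_le zero_le_one, integral_indicator measurableSet_Ioc,
    Measure.restrict_restrict measurableSet_Ioc,
    Set.inter_eq_left.mpr (Set.Ioc_subset_Ioc hα hαa),
    ← intervalIntegral.integral_of_le (by linarith)]
  have h2 := intervalIntegral.mul_integral_comp_mul_add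
    (f := fun x => a⁻¹ * f (a⁻¹ * (x - α)) * F x) (a := 0) (b := 1) a α
  rw [mul_zero, zero_add, mul_one, add_comm a α] at h2
  rw [← h2, ← intervalIntegral.integral_const_mul]
  refine intervalIntegral.integral_congr fun t _ => ?_
  have h3 : a⁻¹ * (a * t + α - α) = t := by field_simp; ring
  simp only [h3]
  field_simp

theorem transplant_ae_eq (ha : 0 < a) {f g : ℝ → ℝ} (h : f =ᵐ[unitMeasure] g) :
    transplant α a f =ᵐ[unitMeasure] transplant α a g := by
  have h' := (ae_restrict_iff' measurableSet_Ioc).mp h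
  refine ae_restrict_of_ae ?_
  filter_upwards [ae_comp_affine h' (inv_ne_zero ha.ne') α] with x hx
  by_cases hmem : x ∈ Set.Ioc α (α + a)
  · rw [transplant, transplant, Set.indicator_of_mem hmem, Set.indicator_of_mem hmem, hx]
    constructor
    · have : 0 < x - α := by linarith [hmem.1]
      positivity
    · rw [inv_mul_le_iff₀ ha]
      linarith [hmem.2]
  · rw [transplant, transplant, Set.indicator_of_notMem hmem, Set.indicator_of_notMem hmem]

theorem memLp_transplant (ha : 0 < a) (f : Lp ℝ 2 unitMeasure) :
    MemLp (transplant α a f) 2 unitMeasure := by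
  have hmeas : StronglyMeasurable (transplant α a f) := by
    refine StronglyMeasurable.indicator ?_ measurableSet_Ioc
    exact ((Lp.stronglyMeasurable f).comp_measurable (by fun_prop)).const_mul _
  rw [memLp_two_iff_integrable_sq hmeas.aestronglyMeasurable]
  have hf := (Lp.memLp f).integrable_sq
  have h1 : IntervalIntegrable (fun x => f x ^ 2) volume 0 1 :=
    intervalIntegrable_of_integrable hf zero_mem_unit one_mem_unit
  have h2 := ((h1.comp_mul_left (c := a⁻¹)).comp_sub_right α).const_mul (a⁻¹ ^ 2)
  have h3 : IntegrableOn (fun x => a⁻¹ ^ 2 * f (a⁻¹ * (x - α)) ^ 2) (Set.Ioc α (α + a)) := by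
    rw [← intervalIntegrable_iff_integrableOn_Ioc_of_le (by linarith)]
    convert h2 using 1 <;> simp [add_comm]
  have h4 := (h3.integrable_indicator measurableSet_Ioc).mono_measure
    (Measure.restrict_le_self (s := Set.Ioc (0 : ℝ) 1))
  refine h4.congr (Eventually.of_forall fun x => ?_)
  by_cases hmem : x ∈ Set.Ioc α (α + a)
  · simp only [transplant, Set.indicator_of_mem hmem]
    ring
  · simp only [transplant, Set.indicator_of_notMem hmem]
    ring

theorem prim_transplant_one (hα : 0 ≤ α) (ha : 0 < a) (hαa : α + a ≤ 1) (f : ℝ → ℝ) :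
    prim (transplant α a f) 1 = prim f 1 := by
  have := integral_transplant_mul hα ha hαa f (fun _ => 1)
  simp only [mul_one] at this
  exact this

/-- A transplanted function vanishes outside the subinterval. -/
theorem prim_transplant_eq_zero (hα : 0 ≤ α) (ha : 0 < a) (hαa : α + a ≤ 1) {f : ℝ → ℝ}
    (hf0 : prim f 1 = 0) {c : ℝ} (hc : c ∈ Set.Icc (0 : ℝ) 1) (hcα : c ≤ α ∨ α + a ≤ c) :
    prim (transplant α a f) c = 0 := by
  have h1 : prim (transplant α a f) c
      = ∫ x in (0 : ℝ)..1, transplant α a f x * (Set.Ioc 0 c).indicator (fun _ => 1) x := by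
    have : ∀ x, transplant α a f x * (Set.Ioc 0 c).indicator (fun _ => 1) x
        = (Set.Ioc 0 c).indicator (transplant α a f) x := by
      intro x
      by_cases hx : x ∈ Set.Ioc 0 c <;> simp [hx]
    simp only [this]
    rw [intervalIntegral.integral_of_le zero_le_one, integral_indicator measurableSet_Ioc,
      Measure.restrict_restrict measurableSet_Ioc,
      Set.inter_eq_left.mpr (Set.Ioc_subset_Ioc le_rfl hc.2),
      ← intervalIntegral.integral_of_le hc.1]
    rfl
  rw [h1, integral_transplant_mul hα ha hαa]
  rcases hcα with h | h
  · rw [intervalIntegral.integral_of_le zero_le_one]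
    refine setIntegral_eq_zero_of_forall_eq_zero fun t ht => ?_
    have : a * t + α ∉ Set.Ioc 0 c := fun hm => by nlinarith [hm.2, ht.1]
    simp [this]
  · refine Eq.trans ?_ hf0
    rw [prim, intervalIntegral.integral_of_le zero_le_one,
      intervalIntegral.integral_of_le zero_le_one]
    refine setIntegral_congr_fun measurableSet_Ioc fun t ht => ?_
    have : a * t + α ∈ Set.Ioc 0 c := by
      constructor <;> nlinarith [ht.1, ht.2]
    simp [this]

/-- Transplantation as a linear map of the energy space. -/
noncomputable def transplantₗ (hα : 0 ≤ α) (ha : 0 < a) (hαa : α + a ≤ 1) :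
    EnergySpace →ₗ[ℝ] EnergySpace where
  toFun f := EnergySpace.mk (transplant α a (f : Lp ℝ 2 unitMeasure))
    (memLp_transplant ha _)
    ((prim_transplant_one hα ha hαa _).trans (EnergySpace.prim_one f))
  map_add' f g := by
    refine EnergySpace.ext_ae ((EnergySpace.coe_mk _ _).trans ?_)
    refine (transplant_ae_eq ha (Lp.coeFn_add _ _)).trans ?_
    refine EventuallyEq.trans ?_ (Lp.coeFn_add _ _).symm
    filter_upwards [EnergySpace.coe_mk (memLp_transplant ha (f : Lp ℝ 2 unitMeasure))
      ((prim_transplant_one hα ha hαa _).trans (EnergySpace.prim_one f)),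
      EnergySpace.coe_mk (memLp_transplant ha (g : Lp ℝ 2 unitMeasure))
      ((prim_transplant_one hα ha hαa _).trans (EnergySpace.prim_one g))] with x h1 h2
    rw [Pi.add_apply, h1, h2]
    by_cases hmem : x ∈ Set.Ioc α (α + a)
    · simp only [transplant, Set.indicator_of_mem hmem, Pi.add_apply]
      ring
    · simp only [transplant, Set.indicator_of_notMem hmem, add_zero]
  map_smul' c f := by
    refine EnergySpace.ext_ae ((EnergySpace.coe_mk _ _).trans ?_)
    refine (transplant_ae_eq ha (Lp.coeFn_smul _ _)).trans ?_
    refine EventuallyEq.trans ?_ (Lp.coeFn_smul _ _).symm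
    filter_upwards [EnergySpace.coe_mk (memLp_transplant ha (f : Lp ℝ 2 unitMeasure))
      ((prim_transplant_one hα ha hαa _).trans (EnergySpace.prim_one f))] with x h1
    rw [Pi.smul_apply, RingHom.id_apply, h1]
    by_cases hmem : x ∈ Set.Ioc α (α + a)
    · simp only [transplant, Set.indicator_of_mem hmem, Pi.smul_apply, smul_eq_mul]
      ring
    · simp only [transplant, Set.indicator_of_notMem hmem, smul_zero]

theorem coe_transplantₗ (hα : 0 ≤ α) (ha : 0 < a) (hαa : α + a ≤ 1) (f : EnergySpace) :
    ((transplantₗ hα ha hαa f : EnergySpace) : Lp ℝ 2 unitMeasure)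
      =ᵐ[unitMeasure] transplant α a (f : Lp ℝ 2 unitMeasure) :=
  EnergySpace.coe_mk (memLp_transplant ha _)
    ((prim_transplant_one hα ha hαa _).trans (EnergySpace.prim_one f))

theorem inner_transplantₗ_left (hα : 0 ≤ α) (ha : 0 < a) (hαa : α + a ≤ 1) (f g : EnergySpace) :
    inner ℝ (transplantₗ hα ha hαa f) g = ∫ t in (0 : ℝ)..1,
      (f : Lp ℝ 2 unitMeasure) t * (g : Lp ℝ 2 unitMeasure) (a * t + α) := by
  rw [EnergySpace.inner_eq, ← integral_transplant_mul hα ha hαa]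
  refine intervalIntegral.integral_congr_ae ?_
  filter_upwards [ae_restrict_uIoc (coe_transplantₗ hα ha hαa f) zero_mem_unit one_mem_unit]
    with x hx hx1
  rw [hx hx1]

theorem inner_transplantₗ (hα : 0 ≤ α) (ha : 0 < a) (hαa : α + a ≤ 1) (f g : EnergySpace) :
    inner ℝ (transplantₗ hα ha hαa f) (transplantₗ hα ha hαa g) = a⁻¹ * inner ℝ f g := by
  have h1 : inner ℝ (transplantₗ hα ha hαa f) (transplantₗ hα ha hαa g)
      = ∫ x in (0 : ℝ)..1, transplant α a (f : Lp ℝ 2 unitMeasure) x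
        * transplant α a (g : Lp ℝ 2 unitMeasure) x := by
    rw [EnergySpace.inner_eq]
    refine intervalIntegral.integral_congr_ae ?_
    filter_upwards [ae_restrict_uIoc (coe_transplantₗ hα ha hαa f) zero_mem_unit one_mem_unit,
      ae_restrict_uIoc (coe_transplantₗ hα ha hαa g) zero_mem_unit one_mem_unit] with x hx hx' hx1
    rw [hx hx1, hx' hx1]
  rw [h1, integral_transplant_mul hα ha hαa, EnergySpace.inner_eq,
    ← intervalIntegral.integral_const_mul]
  refine intervalIntegral.integral_congr_ae (Eventually.of_forall fun t ht => ?_)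
  rw [Set.uIoc_of_le zero_le_one] at ht
  rw [transplant_affine ha _ ht]
  ring

/-- Transplantation multiplies squared energy norms by `1 / a`: the derivative gains a factor
`1 / a`, the length of the interval a factor `a`. -/
theorem norm_sq_transplantₗ (hα : 0 ≤ α) (ha : 0 < a) (hαa : α + a ≤ 1) (f : EnergySpace) :
    ‖transplantₗ hα ha hαa f‖ ^ 2 = a⁻¹ * ‖f‖ ^ 2 := by
  rw [← real_inner_self_eq_norm_sq, inner_transplantₗ, real_inner_self_eq_norm_sq]

/-- Transplantation as a bounded operator of the energy space. -/
noncomputable def transplantL (hα : 0 ≤ α) (ha : 0 < a) (hαa : α + a ≤ 1) :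
    EnergySpace →L[ℝ] EnergySpace :=
  (transplantₗ hα ha hαa).mkContinuous (√a⁻¹) fun f => by
    refine (pow_le_pow_iff_left₀ (norm_nonneg _) (by positivity) two_ne_zero).mp ?_
    rw [mul_pow, Real.sq_sqrt (by positivity), norm_sq_transplantₗ]

theorem transplantL_apply (hα : 0 ≤ α) (ha : 0 < a) (hαa : α + a ≤ 1) (f : EnergySpace) :
    transplantL hα ha hαa f = transplantₗ hα ha hαa f := rfl

/-- Rescaling a function on the subinterval to the unit interval: a multiple of the adjoint of
transplantation, and a left inverse of it. -/
noncomputable def rescaleL (hα : 0 ≤ α) (ha : 0 < a) (hαa : α + a ≤ 1) :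
    EnergySpace →L[ℝ] EnergySpace :=
  a • ContinuousLinearMap.adjoint (transplantL hα ha hαa)

theorem inner_rescaleL (hα : 0 ≤ α) (ha : 0 < a) (hαa : α + a ≤ 1) (f g : EnergySpace) :
    inner ℝ (rescaleL hα ha hαa f) g = a * inner ℝ f (transplantL hα ha hαa g) := by
  rw [rescaleL, smul_apply, inner_smul_left,
    ContinuousLinearMap.adjoint_inner_left]
  rfl

theorem rescaleL_transplantL (hα : 0 ≤ α) (ha : 0 < a) (hαa : α + a ≤ 1) (f : EnergySpace) :
    rescaleL hα ha hαa (transplantL hα ha hαa f) = f := by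
  refine ext_inner_right ℝ fun g => ?_
  rw [inner_rescaleL, transplantL_apply, transplantL_apply, inner_transplantₗ]
  field_simp

theorem norm_sq_rescaleL_le (hα : 0 ≤ α) (ha : 0 < a) (hαa : α + a ≤ 1) (f : EnergySpace) :
    ‖rescaleL hα ha hαa f‖ ^ 2 ≤ a * ‖f‖ ^ 2 := by
  set r := rescaleL hα ha hαa f with hr
  have h1 : ‖r‖ ^ 2 = a * inner ℝ f (transplantL hα ha hαa r) := by
    rw [← inner_rescaleL, ← hr, real_inner_self_eq_norm_sq]
  have h2 := real_inner_le_norm f (transplantL hα ha hαa r)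
  have h3 : ‖transplantL hα ha hαa r‖ ^ 2 = a⁻¹ * ‖r‖ ^ 2 := norm_sq_transplantₗ hα ha hαa r
  have h4 : a * ‖transplantL hα ha hαa r‖ ^ 2 = ‖r‖ ^ 2 := by rw [h3]; field_simp
  -- `2 x y ≤ x² + y²` with `x = ‖f‖`, `y = ‖J r‖`
  nlinarith [sq_nonneg (‖f‖ - ‖transplantL hα ha hαa r‖)]

/-- The derivative of `y (a t + α)`, where `y' = f`. -/
noncomputable def rescale (α a : ℝ) (f : ℝ → ℝ) (t : ℝ) : ℝ := a * f (a * t + α)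

theorem prim_rescale (hα : 0 ≤ α) (ha : 0 < a) (hαa : α + a ≤ 1) {f : ℝ → ℝ}
    (hf : Integrable f unitMeasure) {t : ℝ} (ht : t ∈ Set.Icc (0 : ℝ) 1) :
    prim (rescale α a f) t = prim f (a * t + α) - prim f α := by
  rw [← prim_sub_prim hf ⟨hα, by linarith⟩ ⟨by nlinarith [ht.1], by nlinarith [ht.2]⟩]
  have h2 := intervalIntegral.mul_integral_comp_mul_add (f := f) (a := 0) (b := t) a α
  rw [mul_zero, zero_add] at h2
  rw [← h2, prim, ← intervalIntegral.integral_const_mul]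
  rfl

theorem memLp_rescale (hα : 0 ≤ α) (ha : 0 < a) (hαa : α + a ≤ 1) (f : Lp ℝ 2 unitMeasure) :
    MemLp (rescale α a f) 2 unitMeasure := by
  have hmeas : StronglyMeasurable (rescale α a f) :=
    ((Lp.stronglyMeasurable f).comp_measurable (by fun_prop)).const_mul _
  rw [memLp_two_iff_integrable_sq hmeas.aestronglyMeasurable]
  have hf := (Lp.memLp f).integrable_sq
  have h1 : IntervalIntegrable (fun x => f x ^ 2) volume α (α + a) :=
    intervalIntegrable_of_integrable hf ⟨hα, by linarith⟩ ⟨by linarith, hαa⟩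
  have h2 := ((h1.comp_add_right α).comp_mul_left (c := a)).const_mul (a ^ 2)
  have h3 : IntervalIntegrable (fun x => a ^ 2 * f (a * x + α) ^ 2) volume 0 1 := by
    convert h2 using 1 <;> simp [ha.ne']
  rw [intervalIntegrable_iff_integrableOn_Ioc_of_le zero_le_one] at h3
  refine h3.congr (Eventually.of_forall fun x => ?_)
  simp only [rescale]
  ring

/-- For functions vanishing at both ends of the subinterval, the adjoint rescaling is the
composition with the affine map. -/
theorem coe_rescaleL (hα : 0 ≤ α) (ha : 0 < a) (hαa : α + a ≤ 1) (f : EnergySpace)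
    (h0 : prim (f : Lp ℝ 2 unitMeasure) α = 0) (h1 : prim (f : Lp ℝ 2 unitMeasure) (α + a) = 0) :
    ((rescaleL hα ha hαa f : EnergySpace) : Lp ℝ 2 unitMeasure)
      =ᵐ[unitMeasure] rescale α a (f : Lp ℝ 2 unitMeasure) := by
  have hmean : prim (rescale α a (f : Lp ℝ 2 unitMeasure)) 1 = 0 := by
    rw [prim_rescale hα ha hαa (EnergySpace.integrable f) one_mem_unit, mul_one, add_comm a, h0,
      h1, sub_zero]
  have key : rescaleL hα ha hαa f
      = EnergySpace.mk _ (memLp_rescale hα ha hαa (f : Lp ℝ 2 unitMeasure)) hmean := by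
    refine ext_inner_right ℝ fun g => ?_
    rw [inner_rescaleL, transplantL_apply, real_inner_comm, inner_transplantₗ_left,
      EnergySpace.inner_eq, ← intervalIntegral.integral_const_mul]
    refine intervalIntegral.integral_congr_ae ?_
    filter_upwards [ae_restrict_uIoc (EnergySpace.coe_mk
      (memLp_rescale hα ha hαa (f : Lp ℝ 2 unitMeasure)) hmean) zero_mem_unit one_mem_unit]
      with x hx hx1
    rw [hx hx1, rescale]
    ring
  rw [key]
  exact EnergySpace.coe_mk _ _

end Transplant

/-! ### Bump functions -/

/-- The derivative of the tent function of height `1` with support `[c - ε, c + ε]`. -/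
noncomputable def bump (c ε : ℝ) (x : ℝ) : ℝ :=
  (Set.Ioc (c - ε) c).indicator (fun _ => ε⁻¹) x - (Set.Ioc c (c + ε)).indicator (fun _ => ε⁻¹) x

section Bump

variable {c ε : ℝ}

theorem memLp_bump : MemLp (bump c ε) 2 unitMeasure := by
  refine MemLp.sub ?_ ?_ <;>
  exact memLp_indicator_const 2 measurableSet_Ioc _ (Or.inr (measure_ne_top _ _))

theorem bump_eq_zero {x : ℝ} (hx : x ≤ c - ε ∨ c + ε < x) (hε : 0 < ε) : bump c ε x = 0 := by
  have h1 : x ∉ Set.Ioc (c - ε) c := fun h => by rcases hx with hx | hx <;> linarith [h.1, h.2]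
  have h2 : x ∉ Set.Ioc c (c + ε) := fun h => by rcases hx with hx | hx <;> linarith [h.1, h.2]
  simp [bump, h1, h2]

theorem integral_bump_left (hε : 0 < ε) : ∫ x in (c - ε)..c, bump c ε x = 1 := by
  have : ∫ x in (c - ε)..c, bump c ε x = ∫ x in (c - ε)..c, ε⁻¹ := by
    refine intervalIntegral.integral_congr_ae (Eventually.of_forall fun x hx => ?_)
    rw [Set.uIoc_of_le (by linarith)] at hx
    have h2 : x ∉ Set.Ioc c (c + ε) := fun h => by linarith [h.1, hx.2]
    simp [bump, h2, hx]
  rw [this, intervalIntegral.integral_const, smul_eq_mul]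
  field_simp
  ring

theorem integral_bump_right (hε : 0 < ε) : ∫ x in c..(c + ε), bump c ε x = -1 := by
  have : ∫ x in c..(c + ε), bump c ε x = ∫ x in c..(c + ε), -ε⁻¹ := by
    refine intervalIntegral.integral_congr_ae (Eventually.of_forall fun x hx => ?_)
    rw [Set.uIoc_of_le (by linarith)] at hx
    have h2 : x ∉ Set.Ioc (c - ε) c := fun h => by linarith [h.2, hx.1]
    simp [bump, h2, hx]
  rw [this, intervalIntegral.integral_const, smul_eq_mul]
  field_simp
  ring

theorem prim_bump_of_le (hε : 0 < ε) {x : ℝ} (hx0 : 0 ≤ x) (hx : x ≤ c - ε) :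
    prim (bump c ε) x = 0 := by
  rw [prim, intervalIntegral.integral_of_le hx0]
  exact setIntegral_eq_zero_of_forall_eq_zero fun t ht =>
    bump_eq_zero (Or.inl (ht.2.trans hx)) hε

theorem integrable_bump : Integrable (bump c ε) unitMeasure := integrable_of_memLp_two memLp_bump

theorem prim_bump_self (hε : 0 < ε) (hc0 : 0 ≤ c - ε) (hc1 : c + ε ≤ 1) :
    prim (bump c ε) c = 1 := by
  have h := prim_sub_prim (integrable_bump (c := c) (ε := ε)) (u := c - ε) (v := c)
    ⟨hc0, by linarith⟩ ⟨by linarith, by linarith⟩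
  rw [integral_bump_left hε, prim_bump_of_le hε hc0 le_rfl] at h
  linarith

theorem prim_bump_of_ge (hε : 0 < ε) (hc0 : 0 ≤ c - ε) {x : ℝ} (hx : c + ε ≤ x) (hx1 : x ≤ 1) :
    prim (bump c ε) x = 0 := by
  have h1 := prim_sub_prim (integrable_bump (c := c) (ε := ε)) (u := c) (v := c + ε)
    ⟨by linarith, by linarith⟩ ⟨by linarith, by linarith⟩
  have h2 := prim_sub_prim (integrable_bump (c := c) (ε := ε)) (u := c + ε) (v := x)
    ⟨by linarith, by linarith⟩ ⟨by linarith, by linarith⟩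
  have h3 : ∫ t in (c + ε)..x, bump c ε t = 0 := by
    rw [intervalIntegral.integral_of_le hx]
    exact setIntegral_eq_zero_of_forall_eq_zero fun t ht => bump_eq_zero (Or.inr ht.1) hε
  rw [integral_bump_right hε, prim_bump_self hε hc0 (by linarith)] at h1
  rw [h3] at h2
  linarith

/-- Testing the form with a tent at `c` gives minus the jump of `P` at `c` times the value. -/
theorem weightForm_bump {P f : ℝ → ℝ} (hP : MemLp P 2 unitMeasure) (hf : MemLp f 2 unitMeasure)
    (hε : 0 < ε) (hc0 : 0 ≤ c - ε) (hc1 : c + ε ≤ 1) {pl pr : ℝ}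
    (hl : ∀ᵐ x, x ∈ Set.Ioo (c - ε) c → P x = pl)
    (hr : ∀ᵐ x, x ∈ Set.Ioo c (c + ε) → P x = pr) :
    weightForm P f (bump c ε) = -(pr - pl) * prim f c := by
  have hI := integrable_mul_dprod hP hf (memLp_bump (c := c) (ε := ε))
  have hu : c - ε ∈ Set.Icc (0 : ℝ) 1 := ⟨hc0, by linarith⟩
  have hc : c ∈ Set.Icc (0 : ℝ) 1 := ⟨by linarith, by linarith⟩
  have hv : c + ε ∈ Set.Icc (0 : ℝ) 1 := ⟨by linarith, hc1⟩
  have h1 := intervalIntegrable_of_integrable hI zero_mem_unit hu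
  have h2 := intervalIntegrable_of_integrable hI hu hc
  have h3 := intervalIntegrable_of_integrable hI hc hv
  have h4 := intervalIntegrable_of_integrable hI hv one_mem_unit
  have e1 : ∫ x in (0 : ℝ)..(c - ε), P x * dprod f (bump c ε) x = 0 := by
    rw [intervalIntegral.integral_of_le hc0]
    refine setIntegral_eq_zero_of_forall_eq_zero fun x hx => ?_
    rw [dprod, bump_eq_zero (Or.inl hx.2) hε, prim_bump_of_le hε hx.1.le hx.2]
    ring
  have e4 : ∫ x in (c + ε)..1, P x * dprod f (bump c ε) x = 0 := by
    rw [intervalIntegral.integral_of_le hc1]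
    refine setIntegral_eq_zero_of_forall_eq_zero fun x hx => ?_
    rw [dprod, bump_eq_zero (Or.inr hx.1) hε, prim_bump_of_ge hε hc0 hx.1.le hx.2]
    ring
  rw [weightForm, ← intervalIntegral.integral_add_adjacent_intervals h1 (h2.trans (h3.trans h4)),
    ← intervalIntegral.integral_add_adjacent_intervals h2 (h3.trans h4),
    ← intervalIntegral.integral_add_adjacent_intervals h3 h4, e1, e4,
    integral_mul_dprod_of_const hf memLp_bump hc0 (by linarith) hc.2 hl,
    integral_mul_dprod_of_const hf memLp_bump hc.1 (by linarith) hc1 hr,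
    prim_bump_self hε hc0 hc1, prim_bump_of_le hε hc0 le_rfl, prim_bump_of_ge hε hc0 le_rfl hc1]
  ring

end Bump

/-! ### The self-similar structure -/

theorem node_eq_sum (a : ℕ → ℝ) (k : ℕ) : node a k = ∑ i ∈ Finset.Icc 1 k, a i := by
  induction k with
  | zero => simp [node]
  | succ k ih => rw [node, ih, Finset.sum_Icc_succ_top (by omega)]

section Nodes

variable {n : ℕ} {a : ℕ → ℝ}

theorem node_mono (ha : ∀ k ∈ Finset.Icc 1 n, 0 < a k) {i j : ℕ} (hij : i ≤ j) (hj : j ≤ n) :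
    node a i ≤ node a j := by
  rw [node_eq_sum, node_eq_sum]
  refine Finset.sum_le_sum_of_subset_of_nonneg (Finset.Icc_subset_Icc_right hij) fun k hk _ => ?_
  rw [Finset.mem_Icc] at hk
  exact (ha k (Finset.mem_Icc.mpr ⟨hk.1, hk.2.trans hj⟩)).le

theorem node_pred_add {k : ℕ} (hk : 1 ≤ k) : node a (k - 1) + a k = node a k := by
  obtain ⟨k, rfl⟩ := Nat.exists_eq_add_of_le' hk
  rfl

theorem node_mem_unit (ha : ∀ k ∈ Finset.Icc 1 n, 0 < a k) (h1 : ∑ k ∈ Finset.Icc 1 n, a k = 1)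
    {k : ℕ} (hk : k ≤ n) : node a k ∈ Set.Icc (0 : ℝ) 1 :=
  ⟨node_mono ha (Nat.zero_le k) hk, by
    rw [← h1, ← node_eq_sum]; exact node_mono ha hk le_rfl⟩

end Nodes

section Structure

variable {n m : ℕ} {a d β : ℕ → ℝ} {P : ℝ → ℝ}

theorem ae_eq_of_mem_Ioo (hPs : IsSelfSimilar n a d β P) {k : ℕ} (hk : k ∈ Finset.Icc 1 n) :
    ∀ᵐ x, x ∈ Set.Ioo (node a (k - 1)) (node a k) →
      P x = d k * P ((a k)⁻¹ * (x - node a (k - 1))) + β k := by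
  have h := (ae_restrict_iff' measurableSet_Ioo).mp (hPs k hk)
  filter_upwards [h] with x hx hxk
  rw [hx hxk, div_eq_inv_mul]

theorem ae_eq_beta_of_mem_Ioo (hPs : IsSelfSimilar n a d β P) {k : ℕ} (hk : k ∈ Finset.Icc 1 n)
    (hdk : d k = 0) : ∀ᵐ x, x ∈ Set.Ioo (node a (k - 1)) (node a k) → P x = β k := by
  filter_upwards [ae_eq_of_mem_Ioo hPs hk] with x hx hxk
  rw [hx hxk, hdk]
  ring

/-- The form on functions vanishing at the nodes is determined by its values on the `m`-th
interval, where `P` is a rescaled copy of itself up to a constant. -/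
theorem weightForm_of_vanish (ha : ∀ k ∈ Finset.Icc 1 n, 0 < a k)
    (hsum : ∑ k ∈ Finset.Icc 1 n, a k = 1) (hP : MemLp P 2 unitMeasure)
    (hPs : IsSelfSimilar n a d β P) (hm : m ∈ Finset.Icc 1 n)
    (hd : ∀ k ∈ Finset.Icc 1 n, k ≠ m → d k = 0) {f g : ℝ → ℝ} (hf : MemLp f 2 unitMeasure)
    (hg : MemLp g 2 unitMeasure) (hf0 : ∀ k ≤ n, prim f (node a k) = 0)
    (hg0 : ∀ k ≤ n, prim g (node a k) = 0) :
    weightForm P f g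
      = d m * weightForm P (rescale (node a (m - 1)) (a m) f)
          (rescale (node a (m - 1)) (a m) g) := by
  have hm' := Finset.mem_Icc.mp hm
  have hI := integrable_mul_dprod hP hf hg
  have hnode : ∀ k ≤ n, node a k ∈ Set.Icc (0 : ℝ) 1 := fun k hk => node_mem_unit ha hsum hk
  have hsplit : weightForm P f g
      = ∑ k ∈ Finset.range n, ∫ x in (node a k)..(node a (k + 1)), P x * dprod f g x := by
    rw [intervalIntegral.sum_integral_adjacent_intervals fun k hk =>
      intervalIntegrable_of_integrable hI (hnode k hk.le) (hnode (k + 1) hk), weightForm]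
    rw [node_eq_sum a n, hsum]
    rfl
  obtain ⟨i, rfl⟩ : ∃ i, m = i + 1 := ⟨m - 1, by omega⟩
  have hzero : ∀ k ∈ Finset.range n, k ≠ i →
      ∫ x in (node a k)..(node a (k + 1)), P x * dprod f g x = 0 := by
    intro k hk hki
    have hk' : k < n := Finset.mem_range.mp hk
    have hkn : k + 1 ∈ Finset.Icc 1 n := Finset.mem_Icc.mpr ⟨by omega, hk'⟩
    rw [integral_mul_dprod_of_const hf hg (hnode k hk'.le).1
      (node_mono ha (Nat.le_succ k) hk') (hnode (k + 1) hk').2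
      (ae_eq_beta_of_mem_Ioo hPs hkn (hd _ hkn (by omega))), hf0 _ hk'.le, hf0 _ hk']
    ring
  rw [hsplit, Finset.sum_eq_single_of_mem i (Finset.mem_range.mpr (by omega)) hzero]
  set α := node a i with hα
  set b := a (i + 1) with hb
  have hb0 : 0 < b := ha _ hm
  have hαb : node a (i + 1) = α + b := rfl
  have hα0 : 0 ≤ α := (hnode i (by omega)).1
  have hαb1 : α + b ≤ 1 := (hnode (i + 1) hm'.2).2
  have hfi : prim f α = 0 := hf0 i (by omega)
  have hgi : prim g α = 0 := hg0 i (by omega)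
  have hfi' : prim f (α + b) = 0 := hf0 (i + 1) hm'.2
  rw [hαb]
  have hu : α ∈ Set.Icc (0 : ℝ) 1 := ⟨hα0, by linarith⟩
  have hv : α + b ∈ Set.Icc (0 : ℝ) 1 := ⟨by linarith, hαb1⟩
  -- the additive constant does not contribute, since the product vanishes at both ends
  have hconst : ∫ x in α..(α + b), β (i + 1) * dprod f g x = 0 := by
    rw [intervalIntegral.integral_const_mul,
      integral_dprod (integrable_of_memLp_two hf) (integrable_of_memLp_two hg) hu hv, hfi, hfi']
    ring
  have hdI : Integrable (fun x => dprod f g x) unitMeasure := by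
    have := integrable_mul_dprod (P := fun _ => 1) (memLp_const 1) hf hg
    simpa using this
  have h1 : ∫ x in α..(α + b), P x * dprod f g x
      = ∫ x in α..(α + b), d (i + 1) * (P (b⁻¹ * (x - α)) * dprod f g x) := by
    rw [← sub_zero (∫ x in α..(α + b), P x * dprod f g x), ← hconst,
      ← intervalIntegral.integral_sub (intervalIntegrable_of_integrable hI hu hv)
        (intervalIntegrable_of_integrable (hdI.const_mul _) hu hv)]
    refine intervalIntegral.integral_congr_ae ?_
    have hne : ∀ᵐ x : ℝ, x ≠ α + b := by simp [ae_iff]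
    filter_upwards [ae_eq_of_mem_Ioo hPs hm, hne] with x hx hxv hxu
    rw [Set.uIoc_of_le (by linarith)] at hxu
    rw [hx ⟨hxu.1, lt_of_le_of_ne hxu.2 hxv⟩]
    simp only [Nat.add_sub_cancel, ← hα, ← hb]
    ring
  rw [h1, intervalIntegral.integral_const_mul]
  congr 1
  have h2 := intervalIntegral.mul_integral_comp_mul_add
    (f := fun x => P (b⁻¹ * (x - α)) * dprod f g x) (a := 0) (b := 1) b α
  rw [mul_zero, zero_add, mul_one, add_comm b α] at h2
  rw [← h2, weightForm, ← intervalIntegral.integral_const_mul]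
  refine intervalIntegral.integral_congr fun t ht => ?_
  rw [Set.uIcc_of_le zero_le_one] at ht
  have h3 : b⁻¹ * (b * t + α - α) = t := by field_simp; ring
  simp only [Nat.add_sub_cancel, ← hα, h3, dprod]
  rw [prim_rescale hα0 hb0 hαb1 (integrable_of_memLp_two hf) ht,
    prim_rescale hα0 hb0 hαb1 (integrable_of_memLp_two hg) ht, hfi, hgi, rescale, rescale]
  ring

/-- `P` is constant to the left of a node. On the `m`-th interval this follows from the constancy of
`P` on the last interval, of length `a n`, which reappears there with length `a m * a n`. -/
theorem ae_eq_left (ha : ∀ k ∈ Finset.Icc 1 n, 0 < a k) (hsum : ∑ k ∈ Finset.Icc 1 n, a k = 1)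
    (hPs : IsSelfSimilar n a d β P) (hd : ∀ k ∈ Finset.Icc 1 n, k ≠ m → d k = 0) {ε : ℝ}
    (hε1 : ∀ k ∈ Finset.Icc 1 n, ε ≤ a k)
    (hε2 : ∀ k ∈ Finset.Icc 1 n, ∀ j ∈ Finset.Icc 1 n, ε ≤ a k * a j) {k : ℕ}
    (hk : k ∈ Finset.Icc 1 n) (hkn : k ≠ n) :
    ∀ᵐ x, x ∈ Set.Ioo (node a k - ε) (node a k) →
      P x = if k = m then d m * β n + β m else β k := by
  have hk' := Finset.mem_Icc.mp hk
  have hnode := node_pred_add (a := a) hk'.1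
  have hak := ha k hk
  split_ifs with hkm
  · subst hkm
    have hn : n ∈ Finset.Icc 1 n := Finset.mem_Icc.mpr ⟨by omega, le_rfl⟩
    have hnode_n := node_pred_add (a := a) (hk'.1.trans hk'.2)
    have hn1 : node a n = 1 := by rw [node_eq_sum, hsum]
    have h1 := ae_comp_affine (ae_eq_beta_of_mem_Ioo hPs hn (hd n hn (Ne.symm hkn)))
      (inv_ne_zero hak.ne') (node a (k - 1))
    filter_upwards [ae_eq_of_mem_Ioo hPs hk, h1] with x hx hx1 hxk
    rw [hx ⟨by linarith [hxk.1, hε1 k hk], hxk.2⟩, hx1]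
    constructor
    · rw [lt_inv_mul_iff₀ hak]
      have : node a (n - 1) = 1 - a n := by linarith
      rw [this]
      nlinarith [hε2 k hk n hn, hxk.1]
    · rw [inv_mul_lt_iff₀ hak, hn1]
      linarith [hxk.2]
  · filter_upwards [ae_eq_beta_of_mem_Ioo hPs hk (hd k hk hkm)] with x hx hxk
    exact hx ⟨by linarith [hxk.1, hε1 k hk], hxk.2⟩

/-- `P` is constant to the right of a node. On the `m`-th interval this follows from the constancy
of `P` on the first interval, of length `a 1`, which reappears there with length `a m * a 1`. -/
theorem ae_eq_right (ha : ∀ k ∈ Finset.Icc 1 n, 0 < a k)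
    (hPs : IsSelfSimilar n a d β P) (hd : ∀ k ∈ Finset.Icc 1 n, k ≠ m → d k = 0) {ε : ℝ}
    (hε1 : ∀ k ∈ Finset.Icc 1 n, ε ≤ a k)
    (hε2 : ∀ k ∈ Finset.Icc 1 n, ∀ j ∈ Finset.Icc 1 n, ε ≤ a k * a j) {k : ℕ}
    (hk0 : 1 ≤ k) (hk : k + 1 ∈ Finset.Icc 1 n) :
    ∀ᵐ x, x ∈ Set.Ioo (node a k) (node a k + ε) →
      P x = if k + 1 = m then d m * β 1 + β m else β (k + 1) := by
  have hk' := Finset.mem_Icc.mp hk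
  have hak := ha _ hk
  have hnode : node a (k + 1) = node a k + a (k + 1) := rfl
  split_ifs with hkm
  · subst hkm
    have h1n : 1 ∈ Finset.Icc 1 n := Finset.mem_Icc.mpr ⟨le_rfl, by omega⟩
    have h1 := ae_comp_affine (ae_eq_beta_of_mem_Ioo hPs h1n (hd 1 h1n (by omega)))
      (inv_ne_zero hak.ne') (node a k)
    have hnode1 : node a 1 = a 1 := by simp [node]
    filter_upwards [ae_eq_of_mem_Ioo hPs hk, h1] with x hx hx1 hxk
    rw [hx ⟨hxk.1, by linarith [hxk.2, hε1 _ hk]⟩, Nat.add_sub_cancel, hx1]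
    constructor
    · have : 0 < x - node a k := by linarith [hxk.1]
      have h0 : node a (1 - 1) = 0 := rfl
      rw [h0]
      positivity
    · rw [inv_mul_lt_iff₀ hak, hnode1]
      linarith [hxk.2, hε2 _ hk 1 h1n]
  · filter_upwards [ae_eq_beta_of_mem_Ioo hPs hk (hd _ hk hkm)] with x hx hxk
    exact hx ⟨hxk.1, by linarith [hxk.2, hε1 _ hk]⟩

/-- The one-sided values of `P` at a node differ by the number `ζ_k`. At the ends of the `m`-th
interval the one-sided value is that of the rescaled copy of `P` at an end of the unit interval. -/
theorem jump_eq_zeta (n m k : ℕ) (d β : ℕ → ℝ) :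
    (if k + 1 = m then d m * β 1 + β m else β (k + 1)) - (if k = m then d m * β n + β m else β k)
      = zeta n m d β k := by
  unfold zeta
  by_cases h1 : k + 1 = m
  · have h2 : k ≠ m := by omega
    have h3 : m - 1 = k := by omega
    simp only [h1, h2, if_true, if_false, h3]
    ring
  · by_cases h2 : k = m
    · subst h2
      simp only [h1, if_true, if_false]
      ring
    · simp only [h1, h2, if_false]

/-- A width such that the tents at the nodes have disjoint supports, on each half of which `P` is
constant. -/
theorem exists_bump_width (ha : ∀ k ∈ Finset.Icc 1 n, 0 < a k)
    (hsum : ∑ k ∈ Finset.Icc 1 n, a k = 1) :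
    ∃ ε > 0, (∀ k ∈ Finset.Icc 1 n, ε ≤ a k) ∧
      ∀ k ∈ Finset.Icc 1 n, ∀ j ∈ Finset.Icc 1 n, ε ≤ a k * a j := by
  have hne : (Finset.Icc 1 n).Nonempty := by
    by_contra h
    rw [Finset.not_nonempty_iff_eq_empty] at h
    simp [h] at hsum
  obtain ⟨i, hi, hmin⟩ := Finset.exists_min_image _ a hne
  have hi0 := ha i hi
  have hle1 : a i ≤ 1 := by
    rw [← hsum]
    exact Finset.single_le_sum (fun k hk => (ha k hk).le) hi
  refine ⟨a i * a i, by positivity, fun k hk => ?_, fun k hk j hj => ?_⟩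
  · nlinarith [hmin k hk]
  · have := hmin k hk
    have := hmin j hj
    have := ha k hk
    gcongr

end Structure

/-- The form depends on the weight only through its class in `L²`. -/
theorem weightForm_toLp {P : ℝ → ℝ} (hP : MemLp P 2 unitMeasure) (f g : ℝ → ℝ) :
    weightForm (hP.toLp P) f g = weightForm P f g := by
  refine intervalIntegral.integral_congr_ae ?_
  filter_upwards [ae_restrict_uIoc hP.coeFn_toLp zero_mem_unit one_mem_unit] with x h1 hx
  rw [h1 hx]

/-- The indices of the nodes inside the unit interval. -/
abbrev InnerNode (n : ℕ) : Type := {k : ℕ // k ∈ Finset.Icc 1 (n - 1)}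

section Structure

variable {n m : ℕ} {a d β : ℕ → ℝ} {P : ℝ → ℝ}

theorem prim_bump_node (ha : ∀ k ∈ Finset.Icc 1 n, 0 < a k)
    (hsum : ∑ k ∈ Finset.Icc 1 n, a k = 1) {ε : ℝ} (hε : 0 < ε)
    (hε1 : ∀ k ∈ Finset.Icc 1 n, ε ≤ a k) {k : ℕ} (hk : 1 ≤ k) (hkn : k < n) {j : ℕ}
    (hj : j ≤ n) : prim (bump (node a k) ε) (node a j) = if j = k then 1 else 0 := by
  have hnode : ∀ i ≤ n, node a i ∈ Set.Icc (0 : ℝ) 1 := fun i hi => node_mem_unit ha hsum hi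
  have h1 := node_pred_add (a := a) hk
  have h2 : node a (k + 1) = node a k + a (k + 1) := rfl
  have h3 := hε1 k (Finset.mem_Icc.mpr ⟨hk, hkn.le⟩)
  have h4 := hε1 (k + 1) (Finset.mem_Icc.mpr ⟨by omega, hkn⟩)
  have h5 := (hnode (k - 1) (by omega)).1
  have h6 := (hnode (k + 1) hkn).2
  rcases lt_trichotomy j k with hjk | rfl | hjk
  · rw [if_neg hjk.ne]
    refine prim_bump_of_le hε (hnode j hj).1 ?_
    have := node_mono ha (show j ≤ k - 1 by omega) (by omega)
    linarith
  · rw [if_pos rfl, prim_bump_self hε (by linarith) (by linarith)]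
  · rw [if_neg hjk.ne']
    refine prim_bump_of_ge hε (by linarith) ?_ (hnode j hj).2
    have := node_mono ha (show k + 1 ≤ j by omega) hj
    linarith

theorem node_last_eq_one (hsum : ∑ k ∈ Finset.Icc 1 n, a k = 1) : node a n = 1 := by
  rw [node_eq_sum, hsum]

/-- Since `a m ≤ 1` and `a m * d m ^ 2 < 1`, the product `(a m * d m) ^ 2` is less than `1`. -/
theorem mul_lt_one_of_sum_lt (ha : ∀ k ∈ Finset.Icc 1 n, 0 < a k)
    (hsum : ∑ k ∈ Finset.Icc 1 n, a k = 1) (had : ∑ k ∈ Finset.Icc 1 n, a k * |d k| ^ 2 < 1)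
    (hm : m ∈ Finset.Icc 1 n) : a m * d m < 1 := by
  have h1 : a m * |d m| ^ 2 < 1 := lt_of_le_of_lt
    (Finset.single_le_sum (f := fun k => a k * |d k| ^ 2)
      (fun k hk => mul_nonneg (ha k hk).le (sq_nonneg _)) hm) had
  have h2 : a m ≤ 1 := by
    rw [← hsum]
    exact Finset.single_le_sum (fun k hk => (ha k hk).le) hm
  have h3 := ha m hm
  rw [sq_abs] at h1
  have h4 : (a m * d m) ^ 2 < 1 := by
    have : 0 ≤ a m * d m ^ 2 := by positivity
    nlinarith
  nlinarith

/-- The operator of the form `∫ P (y z)'` has the abstract self-similarity, with nodes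
`α_1, …, α_{n-1}` and masses `ζ_1, …, ζ_{n-1}`. -/
theorem exists_selfSimilarOp (ha : ∀ k ∈ Finset.Icc 1 n, 0 < a k)
    (hsum : ∑ k ∈ Finset.Icc 1 n, a k = 1) (had : ∑ k ∈ Finset.Icc 1 n, a k * |d k| ^ 2 < 1)
    (hP : MemLp P 2 unitMeasure) (hPs : IsSelfSimilar n a d β P) (hm : m ∈ Finset.Icc 1 n)
    (hd : ∀ k ∈ Finset.Icc 1 n, k ≠ m → d k = 0) (hdm : 0 < d m) :
    ∃ (e w : InnerNode n → EnergySpace)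
      (J R : EnergySpace →L[ℝ] EnergySpace),
      SelfSimilarOp (weightOp (hP.toLp P)) e w (fun k => zeta n m d β k) (a m) (d m) J R := by
  obtain ⟨ε, hε, hε1, hε2⟩ := exists_bump_width ha hsum
  have hm' := Finset.mem_Icc.mp hm
  have hnode : ∀ k ≤ n, node a k ∈ Set.Icc (0 : ℝ) 1 := fun k hk => node_mem_unit ha hsum hk
  have hlt : ∀ k : InnerNode n, 1 ≤ k.1 ∧ k.1 < n := fun k => by
    have := Finset.mem_Icc.mp k.2
    omega
  have hα : 0 ≤ node a (m - 1) := (hnode _ (by omega)).1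
  have hαm : node a (m - 1) + a m = node a m := node_pred_add hm'.1
  have hαa : node a (m - 1) + a m ≤ 1 := by rw [hαm]; exact (hnode m hm'.2).2
  have ham := ha m hm
  have hw : ∀ k : InnerNode n, prim (bump (node a k) ε) 1 = 0 := by
    intro k
    have := prim_bump_node ha hsum hε hε1 (hlt k).1 (hlt k).2 (j := n) le_rfl
    rwa [node_last_eq_one hsum, if_neg (hlt k).2.ne'] at this
  -- a function vanishing at the interior nodes vanishes at all nodes
  have hvanish : ∀ v : EnergySpace,
      (∀ k : InnerNode n, inner ℝ (EnergySpace.eval (node a k)) v = 0) →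
      ∀ k ≤ n, prim (v : Lp ℝ 2 unitMeasure) (node a k) = 0 := by
    intro v hv k hk
    rcases Nat.eq_zero_or_pos k with rfl | hk0
    · exact prim_zero _
    · rcases hk.eq_or_lt with rfl | hkn
      · rw [node_last_eq_one hsum]
        exact EnergySpace.prim_one v
      · have := hv ⟨k, Finset.mem_Icc.mpr ⟨hk0, by omega⟩⟩
        rwa [EnergySpace.inner_eval v (hnode k hk)] at this
  refine ⟨fun k => EnergySpace.eval (node a k),
    fun k => EnergySpace.mk (bump (node a k) ε) memLp_bump (hw k),
    transplantL hα ham hαa, rescaleL hα ham hαa,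
    { symm := weightOp_isSymmetric _
      inner_bump := ?_, form_bump := ?_, inner_J := ?_
      R_J := rescaleL_transplantL hα ham hαa
      norm_J := ?_
      norm_R := norm_sq_rescaleL_le hα ham hαa
      form_R := ?_
      a_pos := ham, d_pos := hdm
      ad_lt_one := mul_lt_one_of_sum_lt ha hsum had hm }⟩
  · intro i j
    rw [EnergySpace.inner_eval _ (hnode i (hlt i).2.le),
      prim_congr (EnergySpace.coe_mk _ _) (hnode i (hlt i).2.le),
      prim_bump_node ha hsum hε hε1 (hlt j).1 (hlt j).2 (hlt i).2.le]
    simp only [Subtype.ext_iff]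
  · intro y k
    have hk1 : k.1 ∈ Finset.Icc 1 n := Finset.mem_Icc.mpr ⟨(hlt k).1, (hlt k).2.le⟩
    have hk2 : k.1 + 1 ∈ Finset.Icc 1 n := Finset.mem_Icc.mpr ⟨by omega, (hlt k).2⟩
    have h1 := node_pred_add (a := a) (hlt k).1
    have h2 : node a (k + 1) = node a k + a (k + 1) := rfl
    rw [inner_weightOp, weightForm_toLp,
      weightForm_congr ae_eq_rfl (EnergySpace.coe_mk memLp_bump (hw k)),
      weightForm_bump hP (EnergySpace.memLp y) hε
        (by linarith [hε1 _ hk1, (hnode (k - 1) (by have := hlt k; omega)).1])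
        (by linarith [hε1 _ hk2, (hnode (k + 1) (hlt k).2).2])
        (ae_eq_left ha hsum hPs hd hε1 hε2 hk1 (hlt k).2.ne)
        (ae_eq_right ha hPs hd hε1 hε2 (hlt k).1 hk2),
      jump_eq_zeta, EnergySpace.inner_eval _ (hnode k (hlt k).2.le)]
  · intro k u
    rw [EnergySpace.inner_eval _ (hnode k (hlt k).2.le), transplantL_apply,
      prim_congr (coe_transplantₗ hα ham hαa u) (hnode k (hlt k).2.le)]
    refine prim_transplant_eq_zero hα ham hαa (EnergySpace.prim_one u) (hnode k (hlt k).2.le) ?_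
    rcases lt_or_ge k.1 m with h | h
    · exact Or.inl (node_mono ha (by omega) (by omega))
    · exact Or.inr (by rw [hαm]; exact node_mono ha h (hlt k).2.le)
  · intro u
    rw [transplantL_apply, norm_sq_transplantₗ]
    field_simp
  · intro v v' hv hv'
    have hv0 := hvanish v hv
    have hv0' := hvanish v' hv'
    rw [inner_weightOp, inner_weightOp, weightForm_toLp, weightForm_toLp,
      weightForm_of_vanish ha hsum hP hPs hm hd (EnergySpace.memLp v) (EnergySpace.memLp v')
        hv0 hv0',
      weightForm_congr
        (coe_rescaleL hα ham hαa v (hv0 _ (by omega)) (by rw [hαm]; exact hv0 m hm'.2))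
        (coe_rescaleL hα ham hαa v' (hv0' _ (by omega)) (by rw [hαm]; exact hv0' m hm'.2))]

end Structure

/-- All masses are nonzero when positive and negative ones exhaust the nodes. -/
theorem zeta_ne_zero {n m : ℕ} {d β : ℕ → ℝ} (hZ : zPos n m d β + zNeg n m d β = n - 1) {k : ℕ}
    (hk : k ∈ Finset.Icc 1 (n - 1)) : zeta n m d β k ≠ 0 := by
  intro h0
  have hdisj : Disjoint {k ∈ Finset.Icc 1 (n - 1) | 0 < zeta n m d β k}
      {k ∈ Finset.Icc 1 (n - 1) | 0 < -zeta n m d β k} := by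
    rw [Finset.disjoint_filter]
    intro i _ h1 h2
    linarith
  have hsub : {k ∈ Finset.Icc 1 (n - 1) | 0 < zeta n m d β k} ∪
      {k ∈ Finset.Icc 1 (n - 1) | 0 < -zeta n m d β k} ⊆ (Finset.Icc 1 (n - 1)).erase k := by
    intro i hi
    rw [Finset.mem_union, Finset.mem_filter, Finset.mem_filter] at hi
    rw [Finset.mem_erase]
    rcases hi with hi | hi
    · exact ⟨by rintro rfl; linarith [hi.2], hi.1⟩
    · exact ⟨by rintro rfl; linarith [hi.2], hi.1⟩
  have hcard := Finset.card_le_card hsub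
  rw [Finset.card_union_of_disjoint hdisj, Finset.card_erase_of_mem hk, Nat.card_Icc] at hcard
  have hk' := Finset.mem_Icc.mp hk
  unfold zPos zNeg at hZ
  omega

theorem zNeg_eq_card (n m : ℕ) (d β : ℕ → ℝ) : zNeg n m d β
    = Fintype.card {k : InnerNode n // zeta n m d β k < 0} := by
  rw [Fintype.card_subtype, zNeg]
  refine (Finset.card_bij (fun k _ => k.1) ?_ ?_ ?_).symm
  · intro k hk
    rw [Finset.mem_filter] at hk ⊢
    exact ⟨k.2, neg_pos.mpr hk.2⟩
  · intro k _ k' _ h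
    exact Subtype.ext h
  · intro k hk
    rw [Finset.mem_filter] at hk
    exact ⟨⟨k, hk.1⟩, Finset.mem_filter.mpr ⟨Finset.mem_univ _, neg_pos.mp hk.2⟩, rfl⟩

/-! ### Simplicity of the eigenvalues -/

theorem sq_integral_mul_le {μ : Measure ℝ} {u v : ℝ → ℝ} (hu : MemLp u 2 μ) (hv : MemLp v 2 μ) :
    (∫ x, u x * v x ∂μ) ^ 2 ≤ (∫ x, u x ^ 2 ∂μ) * ∫ x, v x ^ 2 ∂μ := by
  have key : ∀ {f g : ℝ → ℝ} (hf : MemLp f 2 μ) (hg : MemLp g 2 μ),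
      inner ℝ (hf.toLp f) (hg.toLp g) = ∫ x, f x * g x ∂μ := by
    intro f g hf hg
    rw [L2.inner_def]
    refine integral_congr_ae ?_
    filter_upwards [hf.coeFn_toLp, hg.coeFn_toLp] with x h1 h2
    rw [h1, h2]
    simp [mul_comm]
  have h := real_inner_mul_inner_self_le (hu.toLp u) (hv.toLp v)
  rw [key, key, key] at h
  simpa only [sq] using h

theorem prim_mul_sq_le {u v : ℝ → ℝ} (hu : MemLp u 2 unitMeasure) (hv : MemLp v 2 unitMeasure)
    {x : ℝ} (hx : x ∈ Set.Icc (0 : ℝ) 1) :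
    prim (fun t => u t * v t) x ^ 2 ≤ prim (fun t => u t ^ 2) x * prim (fun t => v t ^ 2) x := by
  have hle : volume.restrict (Set.Ioc 0 x) ≤ unitMeasure :=
    Measure.restrict_mono (Set.Ioc_subset_Ioc_right hx.2) le_rfl
  simp only [prim, intervalIntegral.integral_of_le hx.1]
  exact sq_integral_mul_le (hu.mono_measure hle) (hv.mono_measure hle)

theorem prim_mono {φ : ℝ → ℝ} (hφ : Integrable φ unitMeasure) (hφ0 : ∀ x, 0 ≤ φ x) {x y : ℝ}
    (hx : 0 ≤ x) (hxy : x ≤ y) (hy : y ≤ 1) : prim φ x ≤ prim φ y := by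
  have h := prim_sub_prim hφ (u := x) (v := y) ⟨hx, hxy.trans hy⟩ ⟨hx.trans hxy, hy⟩
  have h2 : 0 ≤ ∫ t in x..y, φ t := intervalIntegral.integral_nonneg hxy fun t _ => hφ0 t
  linarith

/-- A Grönwall inequality with integrable coefficient: just beyond the last zero `x₀` of
`Φ = prim φ` one has `Φ x ≤ Φ x ∫_{x₀}^x κ` with the integral less than one. -/
theorem prim_eq_zero_of_le_mul_prim {φ κ : ℝ → ℝ} (hφ : Integrable φ unitMeasure)
    (hκ : Integrable κ unitMeasure) (hφ0 : ∀ x, 0 ≤ φ x) (hκ0 : ∀ x, 0 ≤ κ x)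
    (h : ∀ᵐ x ∂unitMeasure, φ x ≤ κ x * prim φ x) : prim φ 1 = 0 := by
  set S : Set ℝ := {x ∈ Set.Icc (0 : ℝ) 1 | prim φ x = 0} with hS
  have hcomp : IsCompact S := by
    refine isCompact_Icc.of_isClosed_subset ?_ (fun x hx => hx.1)
    exact (continuousOn_prim hφ).preimage_isClosed_of_isClosed isClosed_Icc isClosed_singleton
  have hne : S.Nonempty := ⟨0, zero_mem_unit, prim_zero φ⟩
  obtain ⟨hx₀, hx₀S⟩ := hcomp.sSup_mem hne
  set x₀ := sSup S with hx₀def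
  rcases hx₀.2.eq_or_lt with h1 | h1
  · rwa [h1] at hx₀S
  exfalso
  have hK : Tendsto (prim κ) (nhdsWithin x₀ (Set.Ioc x₀ 1)) (nhds (prim κ x₀)) :=
    ((continuousOn_prim hκ) x₀ hx₀).mono_left
      (nhdsWithin_mono _ fun y hy => ⟨hx₀.1.trans hy.1.le, hy.2⟩)
  have hnebot : (nhdsWithin x₀ (Set.Ioc x₀ 1)).NeBot := by
    rw [nhdsWithin_Ioc_eq_nhdsGT h1]
    infer_instance
  obtain ⟨x, hx, hxI⟩ := ((hK.eventually (gt_mem_nhds (lt_add_one (prim κ x₀)))).and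
    self_mem_nhdsWithin).exists
  have hx1 : x ∈ Set.Icc (0 : ℝ) 1 := ⟨hx₀.1.trans hxI.1.le, hxI.2⟩
  have h2 : ∫ t in x₀..x, φ t ≤ ∫ t in x₀..x, κ t * prim φ x := by
    refine intervalIntegral.integral_mono_ae_restrict hxI.1.le
      (intervalIntegrable_of_integrable hφ hx₀ hx1)
      ((intervalIntegrable_of_integrable hκ hx₀ hx1).mul_const _) ?_
    have hsub : Set.Icc x₀ x ⊆ Set.Icc 0 1 := Set.Icc_subset_Icc hx₀.1 hxI.2
    have h' : ∀ᵐ t ∂volume.restrict (Set.Icc (0 : ℝ) 1), φ t ≤ κ t * prim φ t := by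
      rwa [← restrict_Ioc_eq_restrict_Icc]
    filter_upwards [ae_restrict_of_ae_restrict_of_subset hsub h',
      ae_restrict_mem measurableSet_Icc] with t ht htI
    refine ht.trans (mul_le_mul_of_nonneg_left ?_ (hκ0 t))
    exact prim_mono hφ hφ0 (hx₀.1.trans htI.1) htI.2 hxI.2
  rw [intervalIntegral.integral_mul_const, prim_sub_prim hφ hx₀ hx1, prim_sub_prim hκ hx₀ hx1,
    hx₀S, sub_zero] at h2
  have h3 : 0 ≤ prim φ x := by
    rw [← prim_zero φ]; exact prim_mono hφ hφ0 le_rfl hx1.1 hx1.2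
  have h4 : prim φ x = 0 := by nlinarith
  exact absurd (le_csSup hcomp.bddAbove (⟨hx1, h4⟩ : x ∈ S)) (not_le.mpr hxI.1)

/-- The initial value problem in integrated form has only the zero solution: if the quasi-derivative
vanishes at `0`, so does the function. -/
theorem EnergySpace.eq_zero_of_integrated {P : ℝ → ℝ} (hP : MemLp P 2 unitMeasure) {t : ℝ}
    (ht : t ≠ 0) (f : EnergySpace)
    (h : ∀ᵐ x ∂unitMeasure, t * (f : Lp ℝ 2 unitMeasure) x
      = P x * prim (f : Lp ℝ 2 unitMeasure) x
        - prim (fun s => P s * (f : Lp ℝ 2 unitMeasure) s) x) : f = 0 := by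
  have hf := EnergySpace.memLp f
  set φ : ℝ → ℝ := fun x => (f : Lp ℝ 2 unitMeasure) x ^ 2 with hφ
  set p := prim (fun s => P s ^ 2) 1 with hp
  have hp0 : 0 ≤ p := by
    exact intervalIntegral.integral_nonneg zero_le_one fun s _ => sq_nonneg (P s)
  have hφI : Integrable φ unitMeasure := hf.integrable_sq
  have hPI : Integrable (fun s => P s ^ 2) unitMeasure := hP.integrable_sq
  have hκI : Integrable (fun x => 2 / t ^ 2 * (P x ^ 2 + p)) unitMeasure :=
    (hPI.add (integrable_const p)).const_mul _
  have h1 : prim φ 1 = 0 := by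
    refine prim_eq_zero_of_le_mul_prim hφI hκI (fun x => sq_nonneg _)
      (fun x => by positivity) ?_
    filter_upwards [h, ae_restrict_mem measurableSet_Ioc] with x hx hxI
    have hx' := Set.Ioc_subset_Icc_self hxI
    have hΦ0 : 0 ≤ prim φ x := by
      rw [← prim_zero φ]; exact prim_mono hφI (fun x => sq_nonneg _) le_rfl hx'.1 hx'.2
    have e1 : prim (f : Lp ℝ 2 unitMeasure) x ^ 2 ≤ prim φ x := by
      have h2 := prim_mul_sq_le (memLp_const (1 : ℝ)) hf hx'
      have h3 : prim (fun _ => (1 : ℝ) ^ 2) x = x := by simp [prim]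
      rw [h3] at h2
      simp only [one_mul] at h2
      calc _ ≤ x * prim φ x := h2
        _ ≤ 1 * prim φ x := by gcongr; exact hx'.2
        _ = prim φ x := one_mul _
    have e2 : prim (fun s => P s * (f : Lp ℝ 2 unitMeasure) s) x ^ 2 ≤ p * prim φ x := by
      refine (prim_mul_sq_le hP hf hx').trans ?_
      gcongr
      exact prim_mono hPI (fun x => sq_nonneg _) hx'.1 hx'.2 le_rfl
    have e3 : t ^ 2 * φ x ≤ 2 * (P x ^ 2 + p) * prim φ x := by
      have : t ^ 2 * φ x = (t * (f : Lp ℝ 2 unitMeasure) x) ^ 2 := by rw [hφ]; ring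
      rw [this, hx]
      have e4 : P x ^ 2 * prim (f : Lp ℝ 2 unitMeasure) x ^ 2 ≤ P x ^ 2 * prim φ x := by gcongr
      nlinarith [sq_nonneg (P x * prim (f : Lp ℝ 2 unitMeasure) x
        + prim (fun s => P s * (f : Lp ℝ 2 unitMeasure) s) x)]
    have ht2 : 0 < t ^ 2 := by positivity
    calc φ x = t ^ 2 * φ x / t ^ 2 := by field_simp
      _ ≤ 2 * (P x ^ 2 + p) * prim φ x / t ^ 2 := by gcongr
      _ = 2 / t ^ 2 * (P x ^ 2 + p) * prim φ x := by ring
  have h2 : ‖f‖ ^ 2 = 0 := (EnergySpace.norm_sq_eq f).trans h1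
  exact norm_eq_zero.mp (pow_eq_zero_iff two_ne_zero |>.mp h2)

/-- A square-integrable function orthogonal to the energy space is constant. -/
theorem exists_ae_eq_const {G : ℝ → ℝ} (hG : MemLp G 2 unitMeasure)
    (h : ∀ g : EnergySpace, ∫ x in (0 : ℝ)..1, G x * (g : Lp ℝ 2 unitMeasure) x = 0) :
    ∃ C, ∀ᵐ x ∂unitMeasure, G x = C := by
  have hmem : hG.toLp G ∈ EnergySpaceᗮ := by
    intro g hg
    rw [real_inner_comm, inner_eq_integral]
    refine Eq.trans ?_ (h ⟨g, hg⟩)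
    refine intervalIntegral.integral_congr_ae ?_
    filter_upwards [ae_restrict_uIoc hG.coeFn_toLp zero_mem_unit one_mem_unit] with x hx hx1
    rw [hx hx1]
  rw [Submodule.orthogonal_orthogonal, Submodule.mem_span_singleton] at hmem
  obtain ⟨C, hC⟩ := hmem
  refine ⟨C, ?_⟩
  filter_upwards [hG.coeFn_toLp, Lp.coeFn_smul C (Lp.const 2 unitMeasure (1 : ℝ)),
    Lp.coeFn_const (p := 2) (μ := unitMeasure) (1 : ℝ)] with x h1 h2 h3
  rw [← h1, ← hC, h2, Pi.smul_apply, h3]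
  simp

/-- An eigenfunction satisfies the integrated equation `P y - ∫ P y' - t y' = C`; the constant `C`
is minus the value of a quasi-derivative at `0`. -/
theorem exists_integrated_equation {P : ℝ → ℝ} (hP : MemLp P 2 unitMeasure) {t : ℝ}
    {f : EnergySpace} (hf : weightOp (hP.toLp P) f = t • f) :
    ∃ C, ∀ᵐ x ∂unitMeasure, P x * prim (f : Lp ℝ 2 unitMeasure) x
        - prim (fun s => P s * (f : Lp ℝ 2 unitMeasure) s) x
        - t * (f : Lp ℝ 2 unitMeasure) x = C := by
  have hfm := EnergySpace.memLp f
  have hPf : Integrable (fun s => P s * (f : Lp ℝ 2 unitMeasure) s) unitMeasure :=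
    hP.integrable_mul hfm
  have hK : MemLp (prim fun s => P s * (f : Lp ℝ 2 unitMeasure) s) 2 unitMeasure :=
    (memLp_top_prim hPf).mono_exponent le_top
  have hG : MemLp (fun x => P x * prim (f : Lp ℝ 2 unitMeasure) x
      - prim (fun s => P s * (f : Lp ℝ 2 unitMeasure) s) x
      - t * (f : Lp ℝ 2 unitMeasure) x) 2 unitMeasure :=
    ((memLp_mul_prim hP hfm).sub hK).sub (hfm.const_mul t)
  refine exists_ae_eq_const hG fun g => ?_
  have hgm := EnergySpace.memLp g
  have e1 : weightForm P (f : Lp ℝ 2 unitMeasure) (g : Lp ℝ 2 unitMeasure)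
      = t * ∫ x in (0 : ℝ)..1, (f : Lp ℝ 2 unitMeasure) x * (g : Lp ℝ 2 unitMeasure) x := by
    rw [← weightForm_toLp hP, ← inner_weightOp, hf, inner_smul_left, EnergySpace.inner_eq]
    rfl
  have e2 := integral_dprod hPf (EnergySpace.integrable g) zero_mem_unit one_mem_unit
  rw [EnergySpace.prim_one g, prim_zero, prim_zero, mul_zero, mul_zero, sub_zero] at e2
  have i1 : IntervalIntegrable (fun x => P x * dprod (f : Lp ℝ 2 unitMeasure)
      (g : Lp ℝ 2 unitMeasure) x) volume 0 1 :=
    intervalIntegrable_of_integrable (integrable_mul_dprod hP hfm hgm) zero_mem_unit one_mem_unit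
  have i2 : IntervalIntegrable (dprod (fun s => P s * (f : Lp ℝ 2 unitMeasure) s)
      (g : Lp ℝ 2 unitMeasure)) volume 0 1 := by
    refine intervalIntegrable_of_integrable ?_ zero_mem_unit one_mem_unit
    refine Integrable.add ?_ (hK.integrable_mul hgm)
    refine ((memLp_mul_prim hP hgm).integrable_mul hfm).congr (Eventually.of_forall fun x => ?_)
    simp only [Pi.mul_apply]
    ring
  have i3 : IntervalIntegrable (fun x => t * ((f : Lp ℝ 2 unitMeasure) x *
      (g : Lp ℝ 2 unitMeasure) x)) volume 0 1 :=
    (intervalIntegrable_of_integrable (hfm.integrable_mul hgm) zero_mem_unit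
      one_mem_unit).const_mul t
  have e3 : ∀ x, (P x * prim (f : Lp ℝ 2 unitMeasure) x
      - prim (fun s => P s * (f : Lp ℝ 2 unitMeasure) s) x
      - t * (f : Lp ℝ 2 unitMeasure) x) * (g : Lp ℝ 2 unitMeasure) x
      = P x * dprod (f : Lp ℝ 2 unitMeasure) (g : Lp ℝ 2 unitMeasure) x
        - dprod (fun s => P s * (f : Lp ℝ 2 unitMeasure) s) (g : Lp ℝ 2 unitMeasure) x
        - t * ((f : Lp ℝ 2 unitMeasure) x * (g : Lp ℝ 2 unitMeasure) x) := by
    intro x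
    simp only [dprod]
    ring
  simp only [e3]
  rw [intervalIntegral.integral_sub (i1.sub i2) i3, intervalIntegral.integral_sub i1 i2, e2,
    intervalIntegral.integral_const_mul, ← e1, weightForm]
  ring

theorem prim_linear_comb {f g : ℝ → ℝ} (hf : Integrable f unitMeasure)
    (hg : Integrable g unitMeasure) (b c : ℝ) {x : ℝ} (hx : x ∈ Set.Icc (0 : ℝ) 1) :
    prim (fun t => b * f t + c * g t) x = b * prim f x + c * prim g x := by
  rw [prim, intervalIntegral.integral_add
    ((intervalIntegrable_of_integrable hf zero_mem_unit hx).const_mul b)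
    ((intervalIntegrable_of_integrable hg zero_mem_unit hx).const_mul c),
    intervalIntegral.integral_const_mul, intervalIntegral.integral_const_mul]
  rfl

/-- The eigenvalues are simple: a combination of two eigenfunctions for which the constant of the
integrated equation vanishes is zero. -/
theorem weightOp_simple {P : ℝ → ℝ} (hP : MemLp P 2 unitMeasure) {t : ℝ} (ht : t ≠ 0)
    {f g : EnergySpace} (hf0 : f ≠ 0) (hf : weightOp (hP.toLp P) f = t • f)
    (hg : weightOp (hP.toLp P) g = t • g) : ∃ c : ℝ, g = c • f := by
  obtain ⟨Cf, hCf⟩ := exists_integrated_equation hP hf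
  obtain ⟨Cg, hCg⟩ := exists_integrated_equation hP hg
  have hCf0 : Cf ≠ 0 := by
    rintro rfl
    refine hf0 (EnergySpace.eq_zero_of_integrated hP ht f ?_)
    filter_upwards [hCf] with x hx
    linarith
  set c := Cg / Cf with hc
  refine ⟨c, ?_⟩
  rw [← sub_eq_zero]
  have hh : ((g - c • f : EnergySpace) : Lp ℝ 2 unitMeasure) =ᵐ[unitMeasure]
      fun x => 1 * (g : Lp ℝ 2 unitMeasure) x + -c * (f : Lp ℝ 2 unitMeasure) x := by
    refine (Lp.coeFn_sub _ _).trans ?_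
    filter_upwards [Lp.coeFn_smul c (f : Lp ℝ 2 unitMeasure)] with x hx
    have hx' : ((c • f : EnergySpace) : Lp ℝ 2 unitMeasure) x
        = c * (f : Lp ℝ 2 unitMeasure) x := hx
    rw [Pi.sub_apply, hx']
    ring
  refine EnergySpace.eq_zero_of_integrated hP ht _ ?_
  have hPh : (fun s => P s * ((g - c • f : EnergySpace) : Lp ℝ 2 unitMeasure) s) =ᵐ[unitMeasure]
      fun s => 1 * (P s * (g : Lp ℝ 2 unitMeasure) s)
        + -c * (P s * (f : Lp ℝ 2 unitMeasure) s) := by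
    filter_upwards [hh] with x hx
    rw [hx]
    ring
  have hPf : Integrable (fun s => P s * (f : Lp ℝ 2 unitMeasure) s) unitMeasure :=
    hP.integrable_mul (EnergySpace.memLp f)
  have hPg : Integrable (fun s => P s * (g : Lp ℝ 2 unitMeasure) s) unitMeasure :=
    hP.integrable_mul (EnergySpace.memLp g)
  filter_upwards [hCf, hCg, hh, ae_restrict_mem measurableSet_Ioc] with x h1 h2 h3 hxI
  have hx := Set.Ioc_subset_Icc_self hxI
  rw [prim_congr hh hx, prim_congr hPh hx,
    prim_linear_comb (EnergySpace.integrable g) (EnergySpace.integrable f) _ _ hx,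
    prim_linear_comb hPg hPf _ _ hx, h3]
  have h4 : c * Cf = Cg := by rw [hc]; field_simp
  rw [← h1, ← h2] at h4
  linarith

/-! ### Complex eigenfunctions and the operator of the form -/

theorem absolutelyContinuous_of_dist_le {X Y : Type*} [PseudoMetricSpace X] [PseudoMetricSpace Y]
    {f : ℝ → X} {g : ℝ → Y} {u v : ℝ} (hf : AbsolutelyContinuousOnInterval f u v)
    (h : ∀ s t, dist (g s) (g t) ≤ dist (f s) (f t)) : AbsolutelyContinuousOnInterval g u v :=
  squeeze_zero (fun _ => Finset.sum_nonneg fun _ _ => dist_nonneg)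
    (fun _ => Finset.sum_le_sum fun _ _ => h _ _) hf

/-- The pair `(f, g)` of energy functions represents `y`, that is, `y = prim f + i prim g` on the
unit interval. -/
structure Represents (f g : EnergySpace) (y : ℝ → ℂ) : Prop where
  eq : ∀ x ∈ Set.Icc (0 : ℝ) 1, y x = prim (f : Lp ℝ 2 unitMeasure) x
    + prim (g : Lp ℝ 2 unitMeasure) x * Complex.I
  hasDerivAt : ∀ᵐ x ∂unitMeasure, HasDerivAt y ((f : Lp ℝ 2 unitMeasure) x
    + (g : Lp ℝ 2 unitMeasure) x * Complex.I) x

/-- A real function of the Sobolev space is the primitive of an element of the energy space. -/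
theorem exists_energySpace_of_absolutelyContinuous {u : ℝ → ℝ}
    (hu : AbsolutelyContinuousOnInterval u 0 1) (hd : MemLp (deriv u) 2 unitMeasure)
    (h0 : u 0 = 0) (h1 : u 1 = 0) :
    ∃ f : EnergySpace, (∀ x ∈ Set.Icc (0 : ℝ) 1, u x = prim (f : Lp ℝ 2 unitMeasure) x) ∧
      ∀ᵐ x ∂unitMeasure, HasDerivAt u ((f : Lp ℝ 2 unitMeasure) x) x := by
  have hprim : ∀ x ∈ Set.Icc (0 : ℝ) 1, prim (deriv u) x = u x := by
    intro x hx
    have hsub : Set.uIcc 0 x ⊆ Set.uIcc 0 1 := by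
      rw [Set.uIcc_of_le (zero_le_one (α := ℝ))]
      exact Set.uIcc_subset_Icc zero_mem_unit hx
    rw [prim, (hu.mono hsub).integral_deriv_eq_sub, h0, sub_zero]
  have h10 : prim (deriv u) 1 = 0 := by rw [hprim 1 one_mem_unit, h1]
  refine ⟨EnergySpace.mk (deriv u) hd h10, fun x hx => ?_, ?_⟩
  · rw [prim_congr (EnergySpace.coe_mk hd h10) hx, hprim x hx]
  · filter_upwards [EnergySpace.coe_mk hd h10,
      ae_restrict_of_ae hu.ae_differentiableAt, ae_restrict_mem measurableSet_Ioc]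
      with x hx hdiff hmem
    rw [hx]
    refine (hdiff ?_).hasDerivAt
    rw [Set.uIcc_of_le zero_le_one]
    exact Set.Ioc_subset_Icc_self hmem

theorem MemH.exists_represents {y : ℝ → ℂ} (hy : MemH y) : ∃ f g, Represents f g y := by
  have hre : AbsolutelyContinuousOnInterval (fun x => (y x).re) 0 1 := by
    refine absolutelyContinuous_of_dist_le hy.absCont fun s t => ?_
    rw [Real.dist_eq, dist_eq_norm, ← Complex.sub_re]
    exact Complex.abs_re_le_norm _
  have him : AbsolutelyContinuousOnInterval (fun x => (y x).im) 0 1 := by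
    refine absolutelyContinuous_of_dist_le hy.absCont fun s t => ?_
    rw [Real.dist_eq, dist_eq_norm, ← Complex.sub_im]
    exact Complex.abs_im_le_norm _
  have hI : ∀ {x : ℝ}, x ∈ Set.Ioc (0 : ℝ) 1 → x ∈ Set.uIcc (0 : ℝ) 1 := fun {x} hx => by
    rw [Set.uIcc_of_le zero_le_one]
    exact Set.Ioc_subset_Icc_self hx
  have hdy : ∀ᵐ x ∂unitMeasure, HasDerivAt (fun x => (y x).re) (deriv y x).re x ∧
      HasDerivAt (fun x => (y x).im) (deriv y x).im x := by
    filter_upwards [ae_restrict_of_ae hre.ae_differentiableAt,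
      ae_restrict_of_ae him.ae_differentiableAt, ae_restrict_mem measurableSet_Ioc]
      with x h1 h2 hx
    have h3 := (h1 (hI hx)).hasDerivAt.ofReal_comp
    have h4 := (h2 (hI hx)).hasDerivAt.ofReal_comp
    have h5 := h3.add (h4.mul_const Complex.I)
    have h6 : HasDerivAt y _ x := h5.congr_of_eventuallyEq
      (Eventually.of_forall fun t => (Complex.re_add_im (y t)).symm)
    have h7 : HasDerivAt y (deriv y x) x := h6.differentiableAt.hasDerivAt
    exact ⟨Complex.reCLM.hasFDerivAt.comp_hasDerivAt x h7,
      Complex.imCLM.hasFDerivAt.comp_hasDerivAt x h7⟩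
  have hd : MemLp (deriv y) 2 unitMeasure := by
    rw [unitMeasure, restrict_Ioc_eq_restrict_Icc]
    exact hy.deriv_memLp
  obtain ⟨f, hf, hf'⟩ := exists_energySpace_of_absolutelyContinuous hre
    (hd.re.ae_eq (by filter_upwards [hdy] with x hx using hx.1.deriv.symm))
    (by simp [hy.left]) (by simp [hy.right])
  obtain ⟨g, hg, hg'⟩ := exists_energySpace_of_absolutelyContinuous him
    (hd.im.ae_eq (by filter_upwards [hdy] with x hx using hx.2.deriv.symm))
    (by simp [hy.left]) (by simp [hy.right])
  refine ⟨f, g, fun x hx => ?_, ?_⟩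
  · rw [← hf x hx, ← hg x hx, Complex.re_add_im]
  · filter_upwards [hf', hg'] with x h1 h2
    exact (h1.ofReal_comp.add (h2.ofReal_comp.mul_const Complex.I)).congr_of_eventuallyEq
      (Eventually.of_forall fun t => (Complex.re_add_im (y t)).symm)

theorem intervalIntegrable_ofReal {f : ℝ → ℝ} {u v : ℝ} (hf : IntervalIntegrable f volume u v) :
    IntervalIntegrable (fun x => (f x : ℂ)) volume u v := ⟨hf.1.ofReal, hf.2.ofReal⟩

theorem EnergySpace.eq_zero_of_prim_eq_zero (f : EnergySpace)
    (h : ∀ x ∈ Set.Icc (0 : ℝ) 1, prim (f : Lp ℝ 2 unitMeasure) x = 0) : f = 0 := by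
  refine EnergySpace.ext_ae (EventuallyEq.trans ?_ (Lp.coeFn_zero ℝ 2 unitMeasure).symm)
  have hne : ∀ᵐ x : ℝ, x ≠ 1 := by simp [ae_iff]
  filter_upwards [ae_hasDerivAt_prim (EnergySpace.integrable f), ae_restrict_of_ae hne,
    ae_restrict_mem measurableSet_Ioc] with x hx hx1 hmem
  refine hx.unique ((hasDerivAt_const x (0 : ℝ)).congr_of_eventuallyEq ?_)
  filter_upwards [Ioo_mem_nhds hmem.1 (lt_of_le_of_ne hmem.2 hx1)] with t ht
  exact h t (Set.Ioo_subset_Icc_self ht)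

/-- Elements of the energy space give real-valued test functions. -/
theorem represents_ofReal_prim (f : EnergySpace) :
    Represents f 0 (fun x => (prim (f : Lp ℝ 2 unitMeasure) x : ℂ)) := by
  have h0 : ((0 : EnergySpace) : Lp ℝ 2 unitMeasure) =ᵐ[unitMeasure] fun _ => (0 : ℝ) :=
    Lp.coeFn_zero ℝ 2 unitMeasure
  refine ⟨fun x hx => ?_, ?_⟩
  · rw [prim_congr h0 hx]
    simp [prim]
  · filter_upwards [ae_hasDerivAt_prim (EnergySpace.integrable f), h0] with x hx hx0
    rw [hx0]
    simpa using hx.ofReal_comp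

theorem memH_ofReal_prim (f : EnergySpace) :
    MemH (fun x => (prim (f : Lp ℝ 2 unitMeasure) x : ℂ)) where
  absCont := by
    refine absolutelyContinuous_of_dist_le
      (absolutelyContinuous_prim (EnergySpace.integrable f)) fun s t => ?_
    rw [dist_eq_norm, ← Complex.ofReal_sub, Complex.norm_real, ← dist_eq_norm]
  deriv_memLp := by
    rw [← restrict_Ioc_eq_restrict_Icc]
    refine (EnergySpace.memLp f).ofReal.ae_eq ?_
    filter_upwards [ae_hasDerivAt_prim (EnergySpace.integrable f)] with x hx
    exact hx.ofReal_comp.deriv.symm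
  left := by simp
  right := by simp [EnergySpace.prim_one f]

/-- The real form of the pencil on the energy space. -/
noncomputable def realPencil (P : ℝ → ℝ) (l : ℝ) (f g : EnergySpace) : ℝ :=
  inner ℝ f g + l * weightForm P (f : Lp ℝ 2 unitMeasure) (g : Lp ℝ 2 unitMeasure)

section Pencil

variable {P : ℝ → ℝ}

theorem intervalIntegrable_pencil (hP : MemLp P 2 unitMeasure) (l : ℝ) (f g : EnergySpace) :
    IntervalIntegrable (fun x => (f : Lp ℝ 2 unitMeasure) x * (g : Lp ℝ 2 unitMeasure) x
      + l * (P x * dprod (f : Lp ℝ 2 unitMeasure) (g : Lp ℝ 2 unitMeasure) x)) volume 0 1 :=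
  intervalIntegrable_of_integrable
    (((EnergySpace.memLp f).integrable_mul (EnergySpace.memLp g)).add
      ((integrable_mul_dprod hP (EnergySpace.memLp f) (EnergySpace.memLp g)).const_mul l))
    zero_mem_unit one_mem_unit

theorem realPencil_eq_integral (hP : MemLp P 2 unitMeasure) (l : ℝ) (f g : EnergySpace) :
    realPencil P l f g = ∫ x in (0 : ℝ)..1,
      ((f : Lp ℝ 2 unitMeasure) x * (g : Lp ℝ 2 unitMeasure) x
        + l * (P x * dprod (f : Lp ℝ 2 unitMeasure) (g : Lp ℝ 2 unitMeasure) x)) := by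
  rw [realPencil, EnergySpace.inner_eq, weightForm, ← intervalIntegral.integral_const_mul,
    ← intervalIntegral.integral_add]
  · exact intervalIntegrable_of_integrable
      ((EnergySpace.memLp f).integrable_mul (EnergySpace.memLp g)) zero_mem_unit one_mem_unit
  · exact intervalIntegrable_of_integrable
      ((integrable_mul_dprod hP (EnergySpace.memLp f) (EnergySpace.memLp g)).const_mul l)
      zero_mem_unit one_mem_unit

/-- The sesquilinear form in terms of the real forms of real and imaginary parts. -/
theorem pencilForm_eq (hP : MemLp P 2 unitMeasure) (l : ℝ) {f g p q : EnergySpace}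
    {y z : ℝ → ℂ} (hy : Represents f g y) (hz : Represents p q z) :
    pencilForm P l y z = ((realPencil P l f p + realPencil P l g q : ℝ) : ℂ)
      + ((realPencil P l g p - realPencil P l f q : ℝ) : ℂ) * Complex.I := by
  have hfp := intervalIntegrable_pencil hP l f p
  have hgq := intervalIntegrable_pencil hP l g q
  have hgp := intervalIntegrable_pencil hP l g p
  have hfq := intervalIntegrable_pencil hP l f q
  simp only [realPencil_eq_integral hP]
  rw [← intervalIntegral.integral_add hfp hgq, ← intervalIntegral.integral_sub hgp hfq,
    ← intervalIntegral.integral_ofReal, ← intervalIntegral.integral_ofReal,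
    ← intervalIntegral.integral_mul_const, ← intervalIntegral.integral_add
      (intervalIntegrable_ofReal (hfp.add hgq))
      (IntervalIntegrable.mul_const (intervalIntegrable_ofReal (hgp.sub hfq)) _), pencilForm]
  refine intervalIntegral.integral_congr_ae ?_
  filter_upwards [ae_restrict_uIoc hy.hasDerivAt zero_mem_unit one_mem_unit,
    ae_restrict_uIoc hz.hasDerivAt zero_mem_unit one_mem_unit] with x h1 h2 hx
  have hx' : x ∈ Set.Icc (0 : ℝ) 1 := by
    rw [Set.uIoc_of_le zero_le_one] at hx
    exact Set.Ioc_subset_Icc_self hx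
  have h3 : HasDerivAt (fun t => y t * conj (z t)) _ x :=
    (h1 hx).mul (Complex.conjCLE.hasFDerivAt.comp_hasDerivAt x (h2 hx))
  rw [h3.deriv, (h1 hx).deriv, (h2 hx).deriv]
  simp only [Complex.conjCLE_apply, hy.eq x hx', hz.eq x hx',
    ContinuousLinearEquiv.coe_coe, dprod]
  apply Complex.ext <;> simp <;> ring

theorem realPencil_eq_zero_iff (hP : MemLp P 2 unitMeasure) {l : ℝ} (hl : l ≠ 0)
    (f : EnergySpace) :
    (∀ g, realPencil P l f g = 0) ↔ weightOp (hP.toLp P) f = (-l⁻¹) • f := by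
  have key : ∀ g, realPencil P l f g
      = l * inner ℝ (weightOp (hP.toLp P) f - (-l⁻¹) • f) g := by
    intro g
    rw [realPencil, inner_sub_left, inner_weightOp, weightForm_toLp, real_inner_smul_left]
    field_simp
    ring
  constructor
  · intro h
    refine sub_eq_zero.mp (inner_self_eq_zero (𝕜 := ℝ).mp ?_)
    have h1 := h (weightOp (hP.toLp P) f - (-l⁻¹) • f)
    rw [key] at h1
    exact (mul_eq_zero.mp h1).resolve_left hl
  · intro h g
    rw [key, h]
    simp

/-- The real number `l` is an eigenvalue of the boundary value problem if and only if `-1 / l` is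
an eigenvalue of the operator of the form. The real and the imaginary part of a complex
eigenfunction solve the real problem. -/
theorem isEigenvalue_iff (hP : MemLp P 2 unitMeasure) {l : ℝ} (hl : l ≠ 0) :
    IsEigenvalue P l ↔
      Module.End.HasEigenvalue (weightOp (hP.toLp P) : Module.End ℝ EnergySpace) (-l⁻¹) := by
  constructor
  · rintro ⟨y, hy, ⟨x, hx, hyx⟩, h⟩
    obtain ⟨f, g, hfg⟩ := hy.exists_represents
    have hzero : ∀ p, realPencil P l f p = 0 ∧ realPencil P l g p = 0 := by
      intro p
      have h1 := h _ (memH_ofReal_prim p)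
      rw [pencilForm_eq hP l hfg (represents_ofReal_prim p)] at h1
      -- the test function is real: the imaginary part of its pair is zero
      have hw : ∀ f : EnergySpace, realPencil P l f 0 = 0 := fun f => by
        rw [realPencil, ← weightForm_toLp hP, ← inner_weightOp]
        simp
      simp only [hw, add_zero, sub_zero] at h1
      have hre := congrArg Complex.re h1
      have him := congrArg Complex.im h1
      simp only [Complex.add_re, Complex.ofReal_re, Complex.mul_re, Complex.I_re, mul_zero,
        Complex.ofReal_im, Complex.I_im, sub_zero, add_zero, Complex.zero_re,
        Complex.add_im, Complex.mul_im, mul_one, zero_add, Complex.zero_im] at hre him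
      exact ⟨hre, him⟩
    have hev : ∀ f : EnergySpace, (∀ p, realPencil P l f p = 0) → f ≠ 0 →
        Module.End.HasEigenvalue (weightOp (hP.toLp P) : Module.End ℝ EnergySpace) (-l⁻¹) :=
      fun f hf hf0 => Module.End.hasEigenvalue_of_hasEigenvector
        ⟨Module.End.mem_eigenspace_iff.mpr ((realPencil_eq_zero_iff hP hl f).mp hf), hf0⟩
    by_cases hf0 : f = 0
    · refine hev g (fun p => (hzero p).2) fun hg0 => hyx ?_
      have h0 : ((0 : EnergySpace) : Lp ℝ 2 unitMeasure) =ᵐ[unitMeasure] fun _ => (0 : ℝ) :=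
        Lp.coeFn_zero ℝ 2 unitMeasure
      rw [hfg.eq x hx, hf0, hg0, prim_congr h0 hx]
      simp [prim]
    · exact hev f (fun p => (hzero p).1) hf0
  · intro h
    obtain ⟨f, hf, hf0⟩ := h.exists_hasEigenvector
    have hf1 := (realPencil_eq_zero_iff hP hl f).mpr (Module.End.mem_eigenspace_iff.mp hf)
    refine ⟨_, memH_ofReal_prim f, ?_, fun z hz => ?_⟩
    · by_contra! hcon
      exact hf0 (EnergySpace.eq_zero_of_prim_eq_zero f fun x hx => by exact_mod_cast hcon x hx)
    · obtain ⟨p, q, hpq⟩ := hz.exists_represents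
      rw [pencilForm_eq hP l (represents_ofReal_prim f) hpq]
      have hw : ∀ g : EnergySpace, realPencil P l 0 g = 0 := fun g => by
        rw [realPencil, ← weightForm_toLp hP, ← inner_weightOp]
        simp
      simp [hf1, hw]

end Pencil

end SelfSimilarSL

theorem mainTheorem2
    (n m : ℕ) (a d β : ℕ → ℝ) (P : ℝ → ℝ)
    (ha_pos : ∀ k ∈ Finset.Icc 1 n, 0 < a k)
    (ha_sum : ∑ k ∈ Finset.Icc 1 n, a k = 1)
    (had : ∑ k ∈ Finset.Icc 1 n, a k * |d k| ^ 2 < 1)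
    (hP : MemLp P 2 (volume.restrict (Set.Icc 0 1)))
    (hPs : SelfSimilarSL.IsSelfSimilar n a d β P)
    (hm : m ∈ Finset.Icc 1 n)
    (hd : ∀ k ∈ Finset.Icc 1 n, k ≠ m → d k = 0)
    (hdm : 0 < d m)
    (hZneg : 0 < SelfSimilarSL.zNeg n m d β)
    (hZ : SelfSimilarSL.zPos n m d β + SelfSimilarSL.zNeg n m d β = n - 1) :
    -- `lam k` is the eigenvalue `λ_{-k}`, `k ≥ 1`
    ∃ lam : ℕ → ℝ,
      StrictAntiOn lam (Set.Ici 1) ∧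
      lam '' Set.Ici 1 = {l : ℝ | l < 0 ∧ SelfSimilarSL.IsEigenvalue P l} ∧
      ∃ μ : ℕ → ℝ, ∀ l ∈ Finset.Icc 1 (SelfSimilarSL.zNeg n m d β),
        0 < μ l ∧
        (fun k : ℕ => lam (l + k * SelfSimilarSL.zNeg n m d β)) ~[atTop]
          (fun k : ℕ => -μ l * (a m * d m) ^ (-(k : ℤ))) := by
  have hP' : MemLp P 2 SelfSimilarSL.unitMeasure := by
    rw [SelfSimilarSL.unitMeasure, restrict_Ioc_eq_restrict_Icc]
    exact hP
  obtain ⟨e, w, J, R, h⟩ :=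
    SelfSimilarSL.exists_selfSimilarOp ha_pos ha_sum had hP' hPs hm hd hdm
  obtain ⟨lam, hanti, himage, μ, hμ⟩ := h.exists_eigenvalue_asymptotics
    (fun k => SelfSimilarSL.zeta_ne_zero hZ k.2) (SelfSimilarSL.zNeg_eq_card n m d β) hZneg
    (fun t ht f g hf0 hf hg => SelfSimilarSL.weightOp_simple hP' ht.ne' hf0 hf hg)
  refine ⟨lam, hanti, himage.trans ?_, μ, fun l hl => hμ l (Finset.mem_Icc.mp hl).1⟩
  ext l
  simp only [Set.mem_ofPred_eq]
  exact and_congr_right fun hl => (SelfSimilarSL.isEigenvalue_iff hP' hl.ne).symm
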